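/- A \emph{pseudoline} is the image of a line under a homeomorphism of the plane. In a \emph{simple pseudoline arrangement} finitely many pseudolines are given, every two of which intersect in exactly one point, where they cross (locally, up to homeomorphism, like two crossing lines), and no point lies on three of them. A \emph{pseudoline arrangement graph} is a graph isomorphic to one whose vertices are the crossings of a simple pseudoline arrangement and whose edges connect consecutive crossings on a common pseudoline; if there are $\ell$ pseudolines, it has $n=\ell(\ell-1)/2$ vertices. A \emph{wiring diagram} of $\ell$ pseudolines is a sequence of crossings, in left-to-right order, each of which swaps the pseudolines on two adjacent ones of $\ell$ horizontal tracks, such that every two pseudolines cross exactly once. Let $\kappa_{\max}(\ell)$ be the maximum, over all wiring diagrams of $\ell$ pseudolines and all $1\le i<\ell$, of the number of crossings between tracks $i$ and $i+1$ (with $\kappa_{\max}(\ell)=0$ for $\ell\le 1$). Let $\xi_i=i\oplus(i-1)$ for $i\ge1$, where $\oplus$ is bitwise exclusive or. Theorem. There are finite sets $U_n$ ($n\ge 0$) of points in the plane with nonnegative integer coordinates such that: (1) for every $n$, the set $U_n$ is a universal point set for the $n$-vertex pseudoline arrangement graphs: every such graph has a planar straight-line drawing (distinct vertices at distinct points, edges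 drawn as straight segments that meet only at common endpoints and contain no other vertices) with all its vertices placed at points of $U_n$; (2) $|U_n|=O(n\log n)$ as $n\to\infty$; (3) whenever $n=\ell(\ell-1)/2$ for an integer $\ell\ge0$, the set $U_n$ is contained in the grid $\{1,\dots,\kappa_{\max}(\ell)\}\times\{1,\dots,s\}$ with $s=\lfloor 3(\ell-1)/2\rfloor=O(\ell)$ rows (read $s=0$ if $\ell=0$), and for each $1\le i\le s$ its $i$-th row contains exactly $\min(\ell\,\xi_i,\kappa_{\max}(\ell))$ points of $U_n$. -/

import Mathlib

open Set Filter Asymptotics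

/-! ### Pseudolines, arrangements and arrangement graphs -/

/-- The horizontal axis of the plane, as a model line. -/
def horizontalAxis : Set (ℝ × ℝ) := {p | p.2 = 0}

/-- A pseudoline is the image of a line under a homeomorphism of the plane. (All lines are
equivalent under homeomorphisms of the plane, so it suffices to take images of one line.) -/
def IsPseudoline (S : Set (ℝ × ℝ)) : Prop :=
  ∃ h : (ℝ × ℝ) ≃ₜ (ℝ × ℝ), h '' horizontalAxis = S

/-- The point `x` is a crossing of `A` and `B`: some neighborhood of `x` can be mapped
homeomorphically to a neighborhood of the crossing point of two lines (without loss of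
generality the two coordinate axes, crossing at the origin), such that within this neighborhood
`A` and `B` are taken to the two lines. -/
def IsCrossing (A B : Set (ℝ × ℝ)) (x : ℝ × ℝ) : Prop :=
  ∃ φ : OpenPartialHomeomorph (ℝ × ℝ) (ℝ × ℝ),
    x ∈ φ.source ∧ φ x = (0, 0) ∧
      ∀ p ∈ φ.source, (p ∈ A ↔ (φ p).2 = 0) ∧ (p ∈ B ↔ (φ p).1 = 0)

/-- A simple arrangement of `ℓ` pseudolines: any two of them intersect in exactly one point, which
is a crossing, and different pairs have different crossing points, that is, no point lies on three
of the pseudolines. -/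
structure IsSimpleArrangement {ℓ : ℕ} (L : Fin ℓ → Set (ℝ × ℝ)) : Prop where
  pseudoline : ∀ i, IsPseudoline (L i)
  crossing : ∀ i j, i ≠ j → ∃ x, L i ∩ L j = {x} ∧ IsCrossing (L i) (L j) x
  simple : ∀ i j k, i ≠ j → i ≠ k → j ≠ k → L i ∩ L j ∩ L k = ∅

/-- The set of crossing points of a family of curves. -/
def crossingPoints {ℓ : ℕ} (L : Fin ℓ → Set (ℝ × ℝ)) : Set (ℝ × ℝ) :=
  {p | ∃ i j, i ≠ j ∧ p ∈ L i ∧ p ∈ L j}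

/-- The graph of an arrangement: its vertices are the crossings, and its edges connect consecutive
crossings on a common pseudoline, i.e. two crossings such that no further crossing lies strictly
between them along that pseudoline. -/
def arrangementGraph {ℓ : ℕ} (L : Fin ℓ → Set (ℝ × ℝ)) : SimpleGraph (crossingPoints L) where
  Adj p q := p ≠ q ∧ ∃ (i : Fin ℓ) (h : (ℝ × ℝ) ≃ₜ (ℝ × ℝ)) (a b : ℝ),
    h '' horizontalAxis = L i ∧ h (a, 0) = p ∧ h (b, 0) = q ∧
      ∀ t ∈ uIoo a b, h (t, 0) ∉ crossingPoints L
  symm := ⟨by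
    rintro p q ⟨hpq, i, h, a, b, hL, ha, hb, hab⟩
    exact ⟨hpq.symm, i, h, b, a, hL, hb, ha, by rwa [uIoo_comm]⟩⟩
  loopless := ⟨fun _ hp => hp.1 rfl⟩

/-- A pseudoline arrangement graph is a graph isomorphic to the graph of some simple pseudoline
arrangement. -/
def IsArrangementGraph {V : Type*} (G : SimpleGraph V) : Prop :=
  ∃ (ℓ : ℕ) (L : Fin ℓ → Set (ℝ × ℝ)),
    IsSimpleArrangement L ∧ Nonempty (G ≃g arrangementGraph L)

/-! ### Straight-line drawings and universal point sets -/

/-- A planar straight-line drawing: vertices are placed at distinct points, no vertex lies on an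
edge other than as one of its endpoints, and distinct edges do not meet except at common
endpoints. -/
structure IsPlanarStraightLineDrawing {V : Type*} (G : SimpleGraph V) (f : V → ℝ × ℝ) : Prop where
  injective : Function.Injective f
  vertex_edge : ∀ u v w, G.Adj u v → f w ∈ segment ℝ (f u) (f v) → w = u ∨ w = v
  edge_edge : ∀ u v x y, G.Adj u v → G.Adj x y → s(u, v) ≠ s(x, y) →
    Disjoint (openSegment ℝ (f u) (f v)) (openSegment ℝ (f x) (f y))

/-- `P` is a universal point set for the `n`-vertex graphs in the class `C`. -/
def IsUniversalPointSet {n : ℕ} (C : SimpleGraph (Fin n) → Prop) (P : Set (ℝ × ℝ)) : Prop :=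
  ∀ G, C G → ∃ f : Fin n → ℝ × ℝ, (∀ v, f v ∈ P) ∧ IsPlanarStraightLineDrawing G f

/-- The point of the plane with the given natural coordinates. -/
def gridPoint (p : ℕ × ℕ) : ℝ × ℝ := ((p.1 : ℝ), (p.2 : ℝ))

/-! ### Wiring diagrams and level complexity -/

/-- The lower one of the two tracks that meet in the level `t` (tracks and levels are numbered
from `0`, and level `t` is the one between the tracks `t` and `t + 1`). -/
def lowerTrack {ℓ : ℕ} (t : Fin (ℓ - 1)) : Fin ℓ := ⟨t, by omega⟩

/-- The upper one of the two tracks that meet in the level `t`. -/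
def upperTrack {ℓ : ℕ} (t : Fin (ℓ - 1)) : Fin ℓ := ⟨t + 1, by omega⟩

/-- The assignment of pseudolines to tracks after the crossings in the levels `w`, read from left to
right: `trackOccupant w t` is the pseudoline that then lies on track `t`. Initially pseudoline `t`
lies on track `t`, and each crossing swaps the pseudolines on the two tracks of its level. -/
def trackOccupant {ℓ : ℕ} (w : List (Fin (ℓ - 1))) : Equiv.Perm (Fin ℓ) :=
  (w.map fun t => Equiv.swap (lowerTrack t) (upperTrack t)).prod

/-- The two pseudolines that meet in the `k`-th crossing (from the left). -/
def crossingPair {ℓ : ℕ} (w : List (Fin (ℓ - 1))) (k : Fin w.length) : Sym2 (Fin ℓ) :=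
  s(trackOccupant (w.take k) (lowerTrack (w.get k)),
    trackOccupant (w.take k) (upperTrack (w.get k)))

/-- A wiring diagram of `ℓ` pseudolines, given by the left-to-right sequence of the levels of its
crossings; every two pseudolines cross exactly once. -/
structure WiringDiagram (ℓ : ℕ) where
  levels : List (Fin (ℓ - 1))
  cross_once : ∀ i j : Fin ℓ, i ≠ j → ∃! k : Fin levels.length, crossingPair levels k = s(i, j)

/-- The level complexity of a wiring diagram: the maximum number of crossings in a level. -/
def WiringDiagram.complexity {ℓ : ℕ} (D : WiringDiagram ℓ) : ℕ :=
  Finset.univ.sup fun t : Fin (ℓ - 1) => D.levels.count t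

/-- The maximum level complexity of a wiring diagram of `ℓ` pseudolines. -/
noncomputable def kappaMax (ℓ : ℕ) : ℕ := ⨆ D : WiringDiagram ℓ, D.complexity

/-- The level complexities are bounded, so that the supremum in `kappaMax` is a maximum. -/
theorem bddAbove_complexity (ℓ : ℕ) :
    BddAbove (range fun D : WiringDiagram ℓ => D.complexity) := by
  refine ⟨Fintype.card (Sym2 (Fin ℓ)), ?_⟩
  rintro _ ⟨D, rfl⟩
  have hinj : Function.Injective (crossingPair D.levels) := by
    intro k k' hkk
    have hne : trackOccupant (D.levels.take k) (lowerTrack (D.levels.get k)) ≠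
        trackOccupant (D.levels.take k) (upperTrack (D.levels.get k)) := by
      intro h
      have := congrArg Fin.val ((trackOccupant (D.levels.take k)).injective h)
      simp [lowerTrack, upperTrack] at this
    exact (D.cross_once _ _ hne).unique rfl hkk.symm
  have hlen : D.levels.length ≤ Fintype.card (Sym2 (Fin ℓ)) := by
    simpa using Fintype.card_le_of_injective _ hinj
  exact Finset.sup_le fun t _ => List.count_le_length.trans hlen

/-- The sequence `1, 3, 1, 7, 1, 3, 1, 15, …` (for `i = 1, 2, 3, …`), where `^^^` is the bitwise
exclusive or. -/
def xiSeq (i : ℕ) : ℕ := i ^^^ (i - 1)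

/-! Direct all pseudolines so that they pass a fixed pseudoline `z` to its positive side. Then
passing to the positive side of another pseudoline is a strict total order, because a cycle of three
pseudolines would order their crossings with `z` cyclically. Labeled in this order, any three
pseudolines cross one another like three lines of increasing slope, or in the reverse order. Hence
the crossings can be sorted compatibly with the order along each pseudoline, by inserting the
pseudolines one after another. Sweeping over the sorted crossings gives a wiring diagram, so that
every level contains at most `kappaMax ℓ` crossings.

Place the crossings of each level from left to right in a row of their own, higher levels in higher
rows. Every edge follows a track, which meets only the two levels below and above it, so edges stay
within a row or join the rows of neighboring levels, and edges along distinct tracks do not cross.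

A level with `c` crossings fits into row `i` if `c ≤ ℓ * xiSeq i`. Since every `d` consecutive
indices contain one with `d ≤ xiSeq i`, each level takes at most `c / ℓ + 1` rows; over all `ℓ - 1`
levels, which have `ℓ * (ℓ - 1) / 2` crossings in total, these are at most `3 * (ℓ - 1) / 2` rows.
Finally, the sum of the first `s` terms of `xiSeq` is `O(s log s)`. -/

section Orders

variable {α : Type*} {r : α → α → Prop}

theorem isStrictTotalOrder_of_forall_not_cycle (irrefl : ∀ a, ¬ r a a)
    (iff_not_swap : ∀ a b, a ≠ b → (r a b ↔ ¬ r b a))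
    (not_cycle : ∀ a b c, r a b → r b c → ¬ r c a) : IsStrictTotalOrder α r where
  irrefl := irrefl
  trichotomous a b hab hba := by
    by_contra hne
    exact hab ((iff_not_swap a b hne).2 hba)
  trans a b c hab hbc := by
    have hca := not_cycle a b c hab hbc
    rcases eq_or_ne a c with rfl | hac
    · have hab' : a ≠ b := fun h => irrefl b (h ▸ hab)
      exact absurd hbc ((iff_not_swap a b hab').1 hab)
    · exact (iff_not_swap a c hac).2 hca

theorem exists_equiv_fin_of_isStrictTotalOrder [Fintype α] (hr : IsStrictTotalOrder α r)
    {n : ℕ} (hn : Fintype.card α = n) :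
    ∃ e : Fin n ≃ α, ∀ i j, i < j ↔ r (e i) (e j) := by
  classical
  let _ := linearOrderOfSTO r
  exact ⟨(monoEquivOfFin α hn).toEquiv, fun i j => ((monoEquivOfFin α hn).lt_iff_lt).symm⟩

end Orders

section Topology

theorem pos_iff_pos_of_isPreconnected {X : Type*} [TopologicalSpace X] {s : Set X}
    (hs : IsPreconnected s) {g : X → ℝ} (hg : ContinuousOn g s) (hne : ∀ x ∈ s, g x ≠ 0)
    {x y : X} (hx : x ∈ s) (hy : y ∈ s) : 0 < g x ↔ 0 < g y := by
  have pos_of_pos : ∀ x ∈ s, ∀ y ∈ s, 0 < g x → 0 < g y := by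
    intro x hx y hy hpos
    by_contra hy0
    obtain ⟨z, hz, hz0⟩ := hs.intermediate_value hy hx hg ⟨not_lt.1 hy0, hpos.le⟩
    exact hne z hz hz0
  exact ⟨pos_of_pos x hx y hy, pos_of_pos y hy x hx⟩

theorem pos_iff_of_unique_zero {f : ℝ → ℝ} (hf : Continuous f) {c : ℝ}
    (hc : ∀ x, f x = 0 ↔ x = c) (hpos : ∃ x, 0 < f x) (hneg : ∃ x, f x < 0) {x : ℝ} (hx : x ≠ c) :
    0 < f x ↔ (0 < f (c + 1) ↔ c < x) := by
  have right : ∀ {x y}, c < x → c < y → (0 < f x ↔ 0 < f y) :=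
    pos_iff_pos_of_isPreconnected isPreconnected_Ioi hf.continuousOn
      fun y (hy : c < y) h0 => hy.ne' ((hc y).1 h0)
  have left : ∀ {x y}, x < c → y < c → (0 < f x ↔ 0 < f y) :=
    pos_iff_pos_of_isPreconnected isPreconnected_Iio hf.continuousOn
      fun y (hy : y < c) h0 => hy.ne ((hc y).1 h0)
  have opposite : ∀ {x y}, x < c → c < y → (0 < f x ↔ ¬ 0 < f y) := by
    intro x y hxc hcy
    obtain ⟨a, ha⟩ := hpos
    obtain ⟨b, hb⟩ := hneg
    have hb' : ¬ 0 < f b := hb.le.not_gt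
    have hac : a ≠ c := fun h => ha.ne' ((hc a).2 h)
    have hbc : b ≠ c := fun h => hb.ne ((hc b).2 h)
    grind
  rcases hx.lt_or_gt with hxc | hcx
  · simpa only [hxc.not_gt, iff_false] using opposite hxc (lt_add_one c)
  · simpa only [hcx, iff_true] using right hcx (lt_add_one c)

/- In the coordinates of the crossing, every point near it that is not on `B` is joined by a
vertical segment avoiding `B` to a point of `A`. -/
theorem IsCrossing.exists_mem_pos {A B : Set (ℝ × ℝ)} {x : ℝ × ℝ} (hx : IsCrossing A B x)
    {g : ℝ × ℝ → ℝ} (hg : Continuous g) (hB : ∀ p, p ∈ B ↔ g p = 0)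
    (hfreq : ∃ᶠ p in nhds x, 0 < g p) : ∃ p ∈ A, 0 < g p := by
  obtain ⟨φ, hxs, hφx, hφ⟩ := hx
  obtain ⟨r, hr, hball⟩ := Metric.isOpen_iff.1 φ.open_target _ (φ.map_source hxs)
  have hnear : ∀ᶠ p in nhds x, p ∈ φ.source ∧ φ p ∈ Metric.ball (φ x) r :=
    Eventually.and (φ.open_source.mem_nhds hxs)
      (φ.continuousAt hxs (Metric.ball_mem_nhds _ hr))
  obtain ⟨p, hpos, hps, hpr⟩ := (hfreq.and_eventually hnear).exists
  have hqr : ((φ p).1, (0 : ℝ)) ∈ Metric.ball (φ x) r := by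
    rw [hφx, Metric.mem_ball, Prod.dist_eq, sup_lt_iff] at hpr ⊢
    exact ⟨hpr.1, by simpa using hr⟩
  have hsub : segment ℝ (φ p) ((φ p).1, 0) ⊆ φ.target :=
    ((convex_ball _ _).segment_subset hpr hqr).trans hball
  have hne : ∀ q ∈ segment ℝ (φ p) ((φ p).1, 0), (g ∘ φ.symm) q ≠ 0 := by
    intro q hq h0
    have hq1 : q.1 = (φ p).1 := by
      simpa using (Prod.segment_subset _ _ hq).1
    have := (hφ _ (φ.map_target (hsub hq))).2.1 ((hB _).2 h0)
    rw [φ.right_inv (hsub hq), hq1] at this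
    exact hpos.ne' ((hB p).1 ((hφ p hps).2.2 this))
  refine ⟨φ.symm ((φ p).1, 0), ?_, ?_⟩
  · have hq := hsub (right_mem_segment ℝ (φ p) ((φ p).1, 0))
    rw [(hφ _ (φ.map_target hq)).1, φ.right_inv hq]
  · refine (pos_iff_pos_of_isPreconnected (convex_segment _ _).isPreconnected
      (hg.comp_continuousOn (φ.continuousOn_symm.mono hsub)) hne (left_mem_segment ℝ _ _)
      (right_mem_segment ℝ _ _)).1 ?_
    simpa only [Function.comp_apply, φ.left_inv hps] using hpos

theorem mem_iff_snd_symm_eq_zero {S : Set (ℝ × ℝ)} {h : (ℝ × ℝ) ≃ₜ (ℝ × ℝ)}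
    (hS : h '' horizontalAxis = S) (p : ℝ × ℝ) : p ∈ S ↔ (h.symm p).2 = 0 := by
  rw [← hS, h.image_eq_preimage_symm]
  rfl

theorem IsCrossing.exists_mem_snd_symm_pos {A B : Set (ℝ × ℝ)} {h : (ℝ × ℝ) ≃ₜ (ℝ × ℝ)} {x : ℝ}
    (hx : IsCrossing A B (h (x, 0))) (hB : h '' horizontalAxis = B) :
    (∃ p ∈ A, 0 < (h.symm p).2) ∧ ∃ p ∈ A, (h.symm p).2 < 0 := by
  have hcont : Continuous fun p => (h.symm p).2 := continuous_snd.comp h.symm.continuous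
  have hzero := mem_iff_snd_symm_eq_zero hB
  have hfreq : ∀ S : Set ℝ, (0 : ℝ) ∈ closure S →
      ∃ᶠ p in nhds (h (x, 0)), (h.symm p).2 ∈ S := by
    intro S hS
    have htendsto : Tendsto (fun d : ℝ => h (x, d)) (nhds 0) (nhds (h (x, 0))) :=
      Continuous.tendsto (by fun_prop) 0
    exact htendsto.frequently (by simpa using mem_closure_iff_frequently.1 hS)
  refine ⟨hx.exists_mem_pos hcont hzero (hfreq (Ioi 0) (by simp)), ?_⟩
  have hneg := hx.exists_mem_pos (g := fun p => -(h.symm p).2) hcont.neg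
    (fun p => by rw [hzero p, neg_eq_zero])
    (by simpa only [Left.neg_pos_iff, mem_Iio] using hfreq (Iio 0) (by simp))
  simpa only [Left.neg_pos_iff] using hneg

end Topology

section Parametrization

/-- Parametrizations `x ↦ h i (x, 0)` of the curves `L i`, in which `t i j` is the parameter of the
crossing of `L i` with `L j`; the diagonal values `t i i` are irrelevant. -/
structure IsParametrization {ι : Type*} (L : ι → Set (ℝ × ℝ)) (h : ι → (ℝ × ℝ) ≃ₜ (ℝ × ℝ))
    (t : ι → ι → ℝ) : Prop where
  image_eq : ∀ i, h i '' horizontalAxis = L i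
  mem_iff : ∀ i j, i ≠ j → ∀ x, h i (x, 0) ∈ L j ↔ x = t i j

/-- The reflection `(x, y) ↦ (-x, y)`, which reverses a parametrization by the horizontal axis. -/
def reflection : (ℝ × ℝ) ≃ₜ (ℝ × ℝ) := (Homeomorph.neg ℝ).prodCongr (Homeomorph.refl ℝ)

theorem reflection_image_horizontalAxis : reflection '' horizontalAxis = horizontalAxis := by
  rw [reflection.image_eq_preimage_symm]
  rfl

open Classical in
/-- The crossing parameters after reversing the curves `i` for which `D i` fails. -/
noncomputable def reversedParameter {ι : Type*} (D : ι → Prop) (t : ι → ι → ℝ) (i j : ι) : ℝ :=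
  if D i then t i j else -t i j

namespace IsParametrization

variable {ι : Type*} {L : ι → Set (ℝ × ℝ)} {h : ι → (ℝ × ℝ) ≃ₜ (ℝ × ℝ)} {t : ι → ι → ℝ}

theorem apply_mem (hp : IsParametrization L h t) (i : ι) (x : ℝ) : h i (x, 0) ∈ L i :=
  hp.image_eq i ▸ mem_image_of_mem _ rfl

theorem apply_fst_symm (hp : IsParametrization L h t) {i : ι} {p : ℝ × ℝ} (hpi : p ∈ L i) :
    h i (((h i).symm p).1, 0) = p := by
  rw [← (mem_iff_snd_symm_eq_zero (hp.image_eq i) p).1 hpi]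
  exact (h i).apply_symm_apply p

theorem apply_crossing (hp : IsParametrization L h t) {i j : ι} (hij : i ≠ j) :
    h i (t i j, 0) = h j (t j i, 0) := by
  have hpj : h i (t i j, 0) ∈ L j := (hp.mem_iff i j hij _).2 rfl
  have hpi : h j (((h j).symm (h i (t i j, 0))).1, 0) ∈ L i :=
    (hp.apply_fst_symm hpj).symm ▸ hp.apply_mem i _
  rw [← (hp.mem_iff j i hij.symm _).1 hpi, hp.apply_fst_symm hpj]

open Classical in
theorem reverse (hp : IsParametrization L h t) (D : ι → Prop) :
    IsParametrization L (fun i => if D i then h i else reflection.trans (h i))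
      (reversedParameter D t) where
  image_eq i := by
    split_ifs
    · exact hp.image_eq i
    · exact (image_comp (h i) reflection _).trans <|
        reflection_image_horizontalAxis.symm ▸ hp.image_eq i
  mem_iff i j hij x := by
    by_cases hD : D i
    · simpa only [reversedParameter, if_pos hD] using hp.mem_iff i j hij x
    · simp only [reversedParameter, if_neg hD, ← neg_eq_iff_eq_neg]
      exact hp.mem_iff i j hij (-x)

end IsParametrization

theorem IsSimpleArrangement.exists_isParametrization {ℓ : ℕ} {L : Fin ℓ → Set (ℝ × ℝ)}
    (hL : IsSimpleArrangement L) : ∃ h t, IsParametrization L h t := by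
  choose h hh using hL.pseudoline
  have exists_parameter : ∀ i j, ∃ c : ℝ, i ≠ j → ∀ x, h i (x, 0) ∈ L j ↔ x = c := by
    intro i j
    by_cases hij : i = j
    · exact ⟨0, fun hne => absurd hij hne⟩
    obtain ⟨p, hp, -⟩ := hL.crossing i j hij
    obtain ⟨⟨c, d⟩, hd : d = 0, hc⟩ := hh i ▸ (hp ▸ mem_singleton p : p ∈ L i ∩ L j).1
    refine ⟨c, fun _ x => ?_⟩
    have hx : h i (x, 0) ∈ L i := hh i ▸ mem_image_of_mem _ rfl
    rw [← and_iff_right hx (b := _ ∈ L j), ← mem_inter_iff, hp, mem_singleton_iff, ← hc, hd,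
      (h i).injective.eq_iff, Prod.mk_left_inj]
  choose t ht using exists_parameter
  exact ⟨h, t, hh, ht⟩

variable {ℓ : ℕ} {L : Fin ℓ → Set (ℝ × ℝ)} {h : Fin ℓ → (ℝ × ℝ) ≃ₜ (ℝ × ℝ)}
  {t : Fin ℓ → Fin ℓ → ℝ}

theorem IsSimpleArrangement.parameter_ne (hL : IsSimpleArrangement L)
    (hp : IsParametrization L h t) {i j k : Fin ℓ} (hij : i ≠ j) (hik : i ≠ k) (hjk : j ≠ k) :
    t i j ≠ t i k := by
  intro heq
  have hmem : h i (t i j, 0) ∈ L i ∩ L j ∩ L k :=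
    ⟨⟨hp.apply_mem i _, (hp.mem_iff i j hij _).2 rfl⟩, (hp.mem_iff i k hik _).2 heq⟩
  rwa [hL.simple i j k hij hik hjk] at hmem

theorem IsSimpleArrangement.snd_symm_pos_iff (hL : IsSimpleArrangement L)
    (hp : IsParametrization L h t) {i k : Fin ℓ} (hik : i ≠ k) {x : ℝ} (hx : x ≠ t i k) :
    0 < ((h k).symm (h i (x, 0))).2 ↔
      (0 < ((h k).symm (h i (t i k + 1, 0))).2 ↔ t i k < x) := by
  obtain ⟨p, hpik, hcross⟩ := hL.crossing i k hik
  have hp_eq : h k (t k i, 0) = p := by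
    have : h k (t k i, 0) ∈ L i ∩ L k := ⟨(hp.mem_iff k i hik.symm _).2 rfl, hp.apply_mem k _⟩
    rwa [hpik] at this
  rw [← hp_eq] at hcross
  obtain ⟨⟨a, ha, ha0⟩, b, hb, hb0⟩ := hcross.exists_mem_snd_symm_pos (hp.image_eq k)
  refine pos_iff_of_unique_zero (f := fun x : ℝ => ((h k).symm (h i (x, 0))).2) (by fun_prop)
    (fun x => ?_) ⟨((h i).symm a).1, ?_⟩ ⟨((h i).symm b).1, ?_⟩ hx
  · rw [← mem_iff_snd_symm_eq_zero (hp.image_eq k), hp.mem_iff i k hik]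
  · rwa [hp.apply_fst_symm ha]
  · rwa [hp.apply_fst_symm hb]

end Parametrization

section Coherence

variable {ι : Type*}

/-- Crossing parameters `t`, together with a relation `P` whose intended meaning is that the
directed curve `i` passes from the negative to the positive side of `k`. Then
`P i k ↔ t i k < t i j` says that the crossing of `i` and `j` is on the positive side of `k`, and
coherence means that `i` and `j` agree about this. -/
structure IsCoherent (t : ι → ι → ℝ) (P : ι → ι → Prop) : Prop where
  ne : ∀ i j k, i ≠ j → i ≠ k → j ≠ k → t i j ≠ t i k
  side : ∀ i j k, i ≠ j → i ≠ k → j ≠ k → ((P i k ↔ t i k < t i j) ↔ (P j k ↔ t j k < t j i))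

/-- Coherent data in which the curve `z` passes every other curve from its negative to its positive
side, and conversely. -/
structure IsNormalized (t : ι → ι → ℝ) (P : ι → ι → Prop) (z : ι) : Prop
    extends IsCoherent t P where
  pole_left : ∀ j, j ≠ z → P z j
  pole_right : ∀ i, i ≠ z → ¬ P i z

/-- Any three pseudolines `i < j < k` cross one another in the same order as three lines with these
slopes: the crossings `ij`, `ik`, `jk` come in this order or in the reverse order. -/
structure IsConsistent [LinearOrder ι] (t : ι → ι → ℝ) : Prop where
  ne : ∀ i j k, i ≠ j → i ≠ k → j ≠ k → t i j ≠ t i k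
  lt_iff_left : ∀ i j k, i < j → j < k → (t i j < t i k ↔ t j i < t j k)
  lt_iff_right : ∀ i j k, i < j → j < k → (t i j < t i k ↔ t k i < t k j)

theorem IsSimpleArrangement.isCoherent {ℓ : ℕ} {L : Fin ℓ → Set (ℝ × ℝ)}
    {h : Fin ℓ → (ℝ × ℝ) ≃ₜ (ℝ × ℝ)} {t : Fin ℓ → Fin ℓ → ℝ} (hL : IsSimpleArrangement L)
    (hp : IsParametrization L h t) :
    IsCoherent t fun i k => 0 < ((h k).symm (h i (t i k + 1, 0))).2 where
  ne _ _ _ := hL.parameter_ne hp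
  side i j k hij hik hjk := by
    rw [← hL.snd_symm_pos_iff hp hik (hL.parameter_ne hp hij hik hjk),
      ← hL.snd_symm_pos_iff hp hjk (hL.parameter_ne hp hij.symm hjk hik), hp.apply_crossing hij]

namespace IsCoherent

variable {t : ι → ι → ℝ} {P : ι → ι → Prop}

theorem reversedParameter_lt_iff (hc : IsCoherent t P) (D : ι → Prop) {i j k : ι} (hij : i ≠ j)
    (hik : i ≠ k) (hjk : j ≠ k) :
    reversedParameter D t i j < reversedParameter D t i k ↔ (D i ↔ t i j < t i k) := by
  have := hc.ne i j k hij hik hjk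
  grind [reversedParameter]

theorem reverse (hc : IsCoherent t P) (D S : ι → Prop) :
    IsCoherent (reversedParameter D t) fun i k => (P i k ↔ (D i ↔ S k)) where
  ne i j k hij hik hjk := by
    have := hc.ne i j k hij hik hjk
    grind [reversedParameter]
  side i j k hij hik hjk := by
    have := hc.side i j k hij hik hjk
    rw [hc.reversedParameter_lt_iff D hik hij hjk.symm,
      hc.reversedParameter_lt_iff D hjk hij.symm hik.symm]
    grind

theorem exists_isNormalized (hc : IsCoherent t P) (z : ι) :
    ∃ D Q, IsNormalized (reversedParameter D t) Q z :=
  ⟨fun i => i = z ∨ ¬ P i z, _,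
    { hc.reverse _ fun j => j = z ∨ P z j with
      pole_left := by grind
      pole_right := by grind }⟩

end IsCoherent

namespace IsNormalized

variable {t : ι → ι → ℝ} {P : ι → ι → Prop} {z : ι} {i j k : ι}

theorem lt_pole_comm (hn : IsNormalized t P z) (hi : i ≠ z) (hj : j ≠ z) (hij : i ≠ j) :
    t i j < t i z ↔ t j i < t j z := by
  have hside := hn.side i j z hij hi hj
  have hij_ne := hn.ne i j z hij hi hj
  have hji_ne := hn.ne j i z hij.symm hj hi
  have hPi := hn.pole_right i hi
  have hPj := hn.pole_right j hj
  grind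

theorem iff_lt_pole (hn : IsNormalized t P z) (hi : i ≠ z) (hj : j ≠ z) (hij : i ≠ j) :
    P i j ↔ (t i j < t i z ↔ t z j < t z i) := by
  have hside := hn.side i z j hi hij hj.symm
  have hPj := hn.pole_left j hj
  tauto

theorem iff_not_swap (hn : IsNormalized t P z) (hij : i ≠ j) : P i j ↔ ¬ P j i := by
  rcases eq_or_ne i z with rfl | hi
  · exact iff_of_true (hn.pole_left j hij.symm) (hn.pole_right j hij.symm)
  rcases eq_or_ne j z with rfl | hj
  · exact iff_of_false (hn.pole_right i hij) (not_not.2 (hn.pole_left i hij))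
  rw [hn.iff_lt_pole hi hj hij, hn.iff_lt_pole hj hi hij.symm, hn.lt_pole_comm hi hj hij]
  have hne := hn.ne z i j hi.symm hj.symm hij
  grind

theorem lt_iff_of_cycle (hn : IsNormalized t P z) (hij : i ≠ j) (hik : i ≠ k) (hjk : j ≠ k)
    (hPjk : P j k) (hPki : P k i) : t i j < t i k ↔ t j k < t j i := by
  have hside := hn.side i j k hij hik hjk
  have hPik := (hn.iff_not_swap hik.symm).1 hPki
  have hne := hn.ne i j k hij hik hjk
  grind

theorem not_cycle (hn : IsNormalized t P z) (hij : i ≠ j) (hik : i ≠ k) (hjk : j ≠ k)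
    (hPij : P i j) (hPjk : P j k) : ¬ P k i := by
  intro hPki
  have hi : i ≠ z := fun h => hn.pole_right k (h ▸ hik.symm) (h ▸ hPki)
  have hj : j ≠ z := fun h => hn.pole_right i (h ▸ hij) (h ▸ hPij)
  have hk : k ≠ z := fun h => hn.pole_right j (h ▸ hjk) (h ▸ hPjk)
  have before_pole_iff : (t i j < t i z ↔ t j k < t j z) ∧ (t j k < t j z ↔ t k i < t k z) := by
    have hi_iff := hn.lt_iff_of_cycle hij hik hjk hPjk hPki
    have hj_iff := hn.lt_iff_of_cycle hjk hij.symm hik.symm hPki hPij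
    have hij_comm := hn.lt_pole_comm hi hj hij
    have hjk_comm := hn.lt_pole_comm hj hk hjk
    have hki_comm := hn.lt_pole_comm hk hi hik.symm
    grind
  have hij_iff := (hn.iff_lt_pole hi hj hij).1 hPij
  have hjk_iff := (hn.iff_lt_pole hj hk hjk).1 hPjk
  have hki_iff := (hn.iff_lt_pole hk hi hik.symm).1 hPki
  have hne_ij := hn.ne z i j hi.symm hj.symm hij
  grind

theorem isStrictTotalOrder (hn : IsNormalized t P z) :
    IsStrictTotalOrder ι fun i j => i ≠ j ∧ P i j := by
  refine isStrictTotalOrder_of_forall_not_cycle (fun i h => h.1 rfl) (fun i j hij => ?_) ?_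
  · simp only [hij, hij.symm, ne_eq, not_false_eq_true, true_and, hn.iff_not_swap hij]
  · rintro i j k ⟨hij, hPij⟩ ⟨hjk, hPjk⟩ ⟨hki, hPki⟩
    exact hn.not_cycle hij hki.symm hjk hPij hPjk hPki

theorem isConsistent_comp {κ : Type*} [LinearOrder κ] (hn : IsNormalized t P z) {e : κ → ι}
    (he : Function.Injective e) (hmono : ∀ i j, i < j → P (e i) (e j)) :
    IsConsistent fun i j => t (e i) (e j) where
  ne i j k hij hik hjk := hn.ne _ _ _ (he.ne hij) (he.ne hik) (he.ne hjk)
  lt_iff_left i j k hij hjk := by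
    have hik := he.ne (hij.trans hjk).ne
    have hside := hn.side _ _ _ (he.ne hij.ne) hik (he.ne hjk.ne)
    have hne_i := hn.ne _ _ _ (he.ne hij.ne) hik (he.ne hjk.ne)
    have hne_j := hn.ne _ _ _ (he.ne hij.ne') (he.ne hjk.ne) hik
    grind
  lt_iff_right i j k hij hjk := by
    have hik := he.ne (hij.trans hjk).ne
    have hside := hn.side _ _ _ hik (he.ne hij.ne) (he.ne hjk.ne')
    have hPkj := (hn.iff_not_swap (he.ne hjk.ne)).1 (hmono j k hjk)
    have hne_k := hn.ne _ _ _ hik.symm (he.ne hjk.ne') (he.ne hij.ne)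
    grind

end IsNormalized

theorem IsCoherent.exists_isConsistent {n : ℕ} {t : Fin n → Fin n → ℝ} {P : Fin n → Fin n → Prop}
    (hc : IsCoherent t P) :
    ∃ (D : Fin n → Prop) (e : Equiv.Perm (Fin n)),
      IsConsistent fun i j => reversedParameter D t (e i) (e j) := by
  rcases isEmpty_or_nonempty (Fin n) with hempty | ⟨⟨z⟩⟩
  · exact ⟨fun _ => True, Equiv.refl _, hempty.elim, hempty.elim, hempty.elim⟩
  obtain ⟨D, Q, hn⟩ := hc.exists_isNormalized z
  obtain ⟨e, he⟩ :=
    exists_equiv_fin_of_isStrictTotalOrder hn.isStrictTotalOrder (Fintype.card_fin n)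
  exact ⟨D, e, hn.isConsistent_comp e.injective fun i j hij => ((he i j).1 hij).2⟩

end Coherence

section Relabeling

variable {ℓ : ℕ} {L : Fin ℓ → Set (ℝ × ℝ)}

theorem IsSimpleArrangement.comp_equiv (hL : IsSimpleArrangement L) (e : Equiv.Perm (Fin ℓ)) :
    IsSimpleArrangement (L ∘ e) where
  pseudoline _ := hL.pseudoline _
  crossing _ _ hij := hL.crossing _ _ (e.injective.ne hij)
  simple _ _ _ hij hik hjk :=
    hL.simple _ _ _ (e.injective.ne hij) (e.injective.ne hik) (e.injective.ne hjk)

theorem crossingPoints_comp_equiv (L : Fin ℓ → Set (ℝ × ℝ)) (e : Equiv.Perm (Fin ℓ)) :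
    crossingPoints (L ∘ e) = crossingPoints L := by
  ext p
  exact e.exists_congr_left.trans <| exists_congr fun i => by
    refine e.exists_congr_left.trans <| exists_congr fun j => ?_
    simp only [ne_eq, e.symm.injective.eq_iff, Function.comp_apply, e.apply_symm_apply]

theorem nonempty_arrangementGraph_comp_equiv_iso (L : Fin ℓ → Set (ℝ × ℝ))
    (e : Equiv.Perm (Fin ℓ)) : Nonempty (arrangementGraph (L ∘ e) ≃g arrangementGraph L) := by
  refine ⟨Equiv.setCongr (crossingPoints_comp_equiv L e), fun {p q} => ?_⟩
  simp only [arrangementGraph, crossingPoints_comp_equiv, ne_eq, Equiv.setCongr_apply,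
    Subtype.ext_iff, Function.comp_apply]
  exact and_congr_right fun _ => e.symm.exists_congr_left

/-- A simple arrangement whose curves are directed (by the parametrizations) and labeled like lines
of increasing slope. -/
structure IsDirectedArrangement (L : Fin ℓ → Set (ℝ × ℝ)) (h : Fin ℓ → (ℝ × ℝ) ≃ₜ (ℝ × ℝ))
    (t : Fin ℓ → Fin ℓ → ℝ) : Prop extends IsSimpleArrangement L, IsParametrization L h t,
    IsConsistent t

theorem IsSimpleArrangement.exists_isDirectedArrangement (hL : IsSimpleArrangement L) :
    ∃ (e : Equiv.Perm (Fin ℓ)) (h : _) (t : _), IsDirectedArrangement (L ∘ e) h t := by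
  obtain ⟨h, t, hp⟩ := hL.exists_isParametrization
  obtain ⟨D, e, hcons⟩ := (hL.isCoherent hp).exists_isConsistent
  have hp' := hp.reverse D
  exact ⟨e, _, _,
    { hL.comp_equiv e, hcons with
      image_eq := fun i => hp'.image_eq (e i)
      mem_iff := fun i j hij => hp'.mem_iff _ _ (e.injective.ne hij) }⟩

end Relabeling

section Crossings

theorem uIoo_subset_image_uIoo {α δ : Type*} [ConditionallyCompleteLinearOrder α]
    [TopologicalSpace α] [OrderTopology α] [DenselyOrdered α] [LinearOrder δ] [TopologicalSpace δ]
    [OrderClosedTopology δ] {a b : α} {f : α → δ} (hf : ContinuousOn f (uIcc a b)) :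
    uIoo (f a) (f b) ⊆ f '' uIoo a b := by
  wlog hab : a ≤ b generalizing a b
  · rw [uIoo_comm, uIoo_comm a]
    exact this (uIcc_comm a b ▸ hf) (le_of_not_ge hab)
  rw [uIcc_of_le hab] at hf
  rw [uIoo_of_le hab]
  rcases le_total (f a) (f b) with hle | hle
  · rw [uIoo_of_le hle]
    exact intermediate_value_Ioo hab hf
  · rw [uIoo_of_ge hle]
    exact intermediate_value_Ioo' hab hf

variable {ℓ : ℕ} {L : Fin ℓ → Set (ℝ × ℝ)} {h : Fin ℓ → (ℝ × ℝ) ≃ₜ (ℝ × ℝ)} {t : Fin ℓ → Fin ℓ → ℝ}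

theorem IsParametrization.exists_of_adj (hp : IsParametrization L h t) {p q : crossingPoints L}
    (hpq : (arrangementGraph L).Adj p q) :
    ∃ i, ↑p ∈ L i ∧ ↑q ∈ L i ∧ ∀ c ≠ i, t i c ∉ uIoo ((h i).symm p).1 ((h i).symm q).1 := by
  obtain ⟨-, i, g, a, b, hg, hga, hgb, hbetween⟩ := hpq
  have mem : ∀ x, g (x, 0) ∈ L i := fun x => hg ▸ mem_image_of_mem g rfl
  refine ⟨i, hga ▸ mem a, hgb ▸ mem b, fun c hci hc => ?_⟩
  let φ : ℝ → ℝ := fun x => ((h i).symm (g (x, 0))).1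
  have hφ : Continuous φ := by fun_prop
  rw [← hga, ← hgb] at hc
  obtain ⟨x, hx, hxc⟩ := uIoo_subset_image_uIoo (f := φ) hφ.continuousOn hc
  refine hbetween x hx ⟨i, c, hci.symm, mem x, ?_⟩
  rw [← hp.apply_fst_symm (mem x)]
  exact (hp.mem_iff i c hci.symm _).2 hxc

theorem IsSimpleArrangement.eq_or_eq_of_mem (hL : IsSimpleArrangement L) {p : ℝ × ℝ} {i j k : Fin ℓ}
    (hij : i ≠ j) (hi : p ∈ L i) (hj : p ∈ L j) (hk : p ∈ L k) : k = i ∨ k = j := by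
  by_contra! hne
  have : p ∈ L i ∩ L j ∩ L k := ⟨⟨hi, hj⟩, hk⟩
  rwa [hL.simple i j k hij hne.1.symm hne.2.symm] at this

theorem IsSimpleArrangement.exists_equiv_crossingPoints (hL : IsSimpleArrangement L) :
    ∃ c : crossingPoints L ≃ {z : Sym2 (Fin ℓ) // ¬ z.IsDiag},
      ∀ p i j, i ≠ j → ↑p ∈ L i → ↑p ∈ L j → (c p : Sym2 (Fin ℓ)) = s(i, j) := by
  choose i j hij hi hj using fun p : crossingPoints L => p.2
  have eq : ∀ (p : crossingPoints L) k l, k ≠ l → ↑p ∈ L k → ↑p ∈ L l → s(i p, j p) = s(k, l) := by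
    intro p k l hkl hk hl
    have := hL.eq_or_eq_of_mem (hij p) (hi p) (hj p) hk
    have := hL.eq_or_eq_of_mem (hij p) (hi p) (hj p) hl
    grind [Sym2.eq_iff]
  let c (p : crossingPoints L) : {z : Sym2 (Fin ℓ) // ¬ z.IsDiag} :=
    ⟨s(i p, j p), Sym2.mk_isDiag_iff.not.2 (hij p)⟩
  refine ⟨Equiv.ofBijective c ⟨fun p q hpq => ?_, fun ⟨z, hz⟩ => ?_⟩, eq⟩
  · obtain ⟨x, hx, -⟩ := hL.crossing (i p) (j p) (hij p)
    have eq_x : ∀ q : crossingPoints L, ↑q ∈ L (i p) → ↑q ∈ L (j p) → (q : ℝ × ℝ) = x :=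
      fun q hqi hqj => mem_singleton_iff.1 (hx ▸ mem_inter hqi hqj)
    replace hpq : s(i p, j p) = s(i q, j q) := congrArg Subtype.val hpq
    refine Subtype.ext ((eq_x p (hi p) (hj p)).trans (eq_x q ?_ ?_).symm) <;>
      grind [Sym2.eq_iff]
  · induction z with | _ k l
    have hkl := Sym2.mk_isDiag_iff.not.1 hz
    obtain ⟨x, hx, -⟩ := hL.crossing k l hkl
    obtain ⟨hk, hl⟩ : x ∈ L k ∩ L l := hx ▸ mem_singleton x
    exact ⟨⟨x, k, l, hkl, hk, hl⟩, Subtype.ext (eq _ k l hkl hk hl)⟩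

end Crossings

section Sweep

theorem exists_rank {α β : Type*} [LinearOrder β] {s : Finset α} {f : α → β} (hf : InjOn f s) :
    ∃ T : α → ℕ, BijOn T s (Iio s.card) ∧ ∀ a ∈ s, ∀ b, T a < T b ↔ f a < f b := by
  classical
  let T : α → ℕ := fun a => (s.filter fun b => f b < f a).card
  have mono : ∀ a b, f a ≤ f b → T a ≤ T b := fun a b hab =>
    Finset.card_le_card (Finset.monotone_filter_right s fun c _ hc => hc.trans_le hab)
  have lt_iff : ∀ a ∈ s, ∀ b, T a < T b ↔ f a < f b := by
    refine fun a ha b => ⟨fun hT => not_le.1 fun hba => (mono b a hba).not_gt hT, fun hab => ?_⟩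
    refine Finset.card_lt_card ((Finset.ssubset_iff_of_subset ?_).2 ⟨a, by simp [ha, hab], by simp⟩)
    exact Finset.monotone_filter_right s fun c _ hc => lt_trans hc hab
  have injOn : InjOn T s := by
    intro a ha b hb hab
    refine hf ha hb (le_antisymm ?_ ?_) <;> refine not_lt.1 fun hlt => ?_
    · exact ((lt_iff b hb a).2 hlt).ne' hab
    · exact ((lt_iff a ha b).2 hlt).ne hab
  have mapsTo : MapsTo T s (Finset.range s.card) := fun a ha => by
    rw [Finset.coe_range]
    exact Finset.card_lt_card (Finset.filter_ssubset.2 ⟨a, ha, lt_irrefl _⟩)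
  refine ⟨T, ?_, lt_iff⟩
  rw [← Finset.coe_range]
  exact ⟨mapsTo, injOn, Finset.surjOn_of_injOn_of_card_le T mapsTo injOn (by simp)⟩

theorem toColex_lt_of_le_of_lt {ι : Type*} [LinearOrder ι] {β : Type*} [LinearOrder β]
    [WellFoundedGT ι] {a b : ι → β} {k : ι} (hle : ∀ m, k < m → a m ≤ b m) (hlt : a k < b k) :
    toColex a < toColex b := by
  obtain ⟨m, ⟨hkm, hne⟩, hmax⟩ := wellFounded_gt.has_min {m | k ≤ m ∧ a m ≠ b m}
    ⟨k, le_rfl, hlt.ne⟩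
  refine ⟨m, fun j hmj => not_not.1 fun hj => hmax j ⟨hkm.trans hmj.le, hj⟩ hmj, ?_⟩
  rcases hkm.eq_or_lt with rfl | hkm
  · exact hlt
  · exact (hle m hkm).lt_of_ne hne

variable {ℓ : ℕ}

theorem exists_lt_eq_of_not_isDiag {α : Type*} [LinearOrder α] {z : Sym2 α} (hz : ¬ z.IsDiag) :
    ∃ i j, i < j ∧ s(i, j) = z := by
  induction z with | _ i j
  rcases lt_or_gt_of_ne (Sym2.mk_isDiag_iff.not.1 hz) with hij | hji
  · exact ⟨i, j, hij, rfl⟩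
  · exact ⟨j, i, hji, Sym2.eq_swap⟩

/-- The sort key of the crossing `z`, to be compared colexicographically. The coordinate `m` tells
whether `z` precedes `m`, lies on `m` (and where), or succeeds `m`, provided that `m` is not less
than the labels of the two pseudolines of `z`. Inserting the pseudoline `m` into the sweep of its
predecessors thus puts the crossings on `m` between those that precede and those that succeed
`m`. -/
noncomputable def sweepKey (t : Fin ℓ → Fin ℓ → ℝ) (z : Sym2 (Fin ℓ)) (m : Fin ℓ) : EReal :=
  if z.sup < m then if t z.inf z.sup < t z.inf m then ⊥ else ⊤
  else if z.sup = m then t m z.inf else 0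

theorem sweepKey_mk (t : Fin ℓ → Fin ℓ → ℝ) {i j : Fin ℓ} (hij : i < j) :
    sweepKey t s(i, j) = fun m =>
      if j < m then if t i j < t i m then ⊥ else ⊤ else if j = m then (t m i : EReal) else 0 := by
  funext m
  simp only [sweepKey, Sym2.inf_mk, Sym2.sup_mk, inf_of_le_left hij.le, sup_of_le_right hij.le]

namespace IsConsistent

variable {t : Fin ℓ → Fin ℓ → ℝ}

theorem sweepKey_lt (ht : IsConsistent t) {i j k : Fin ℓ} (hij : i < j) (hjk : j < k)
    (hlt : t i j < t i k) :
    toColex (sweepKey t s(i, j)) < toColex (sweepKey t s(i, k)) ∧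
      toColex (sweepKey t s(i, k)) < toColex (sweepKey t s(j, k)) := by
  have hik := hij.trans hjk
  have hk := (ht.lt_iff_right i j k hij hjk).1 hlt
  rw [sweepKey_mk t hij, sweepKey_mk t hjk, sweepKey_mk t hik]
  constructor
  · refine toColex_lt_of_le_of_lt (k := k) (fun m hkm => ?_) ?_
    · grind [bot_le, le_top]
    · simp [hjk, hlt]
  · refine toColex_lt_of_le_of_lt (k := k) (fun m hkm => ?_) ?_
    · have := ht.lt_iff_left i k m hik hkm
      have := ht.lt_iff_left j k m hjk hkm
      grind [bot_le, le_top]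
    · simpa using hk

theorem sweepKey_gt (ht : IsConsistent t) {i j k : Fin ℓ} (hij : i < j) (hjk : j < k)
    (hlt : t i k < t i j) :
    toColex (sweepKey t s(j, k)) < toColex (sweepKey t s(i, k)) ∧
      toColex (sweepKey t s(i, k)) < toColex (sweepKey t s(i, j)) := by
  have hik := hij.trans hjk
  have hk : t k j < t k i := (ht.ne k i j hik.ne' hjk.ne' hij.ne).lt_or_gt.resolve_left
    fun hk => hlt.not_gt ((ht.lt_iff_right i j k hij hjk).2 hk)
  rw [sweepKey_mk t hij, sweepKey_mk t hjk, sweepKey_mk t hik]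
  constructor
  · refine toColex_lt_of_le_of_lt (k := k) (fun m hkm => ?_) ?_
    · have := ht.lt_iff_left i k m hik hkm
      have := ht.lt_iff_left j k m hjk hkm
      grind [bot_le, le_top]
    · simpa using hk
  · refine toColex_lt_of_le_of_lt (k := k) (fun m hkm => ?_) ?_
    · grind [bot_le, le_top]
    · simp [hjk, hlt.not_gt]

theorem injOn_sweepKey (ht : IsConsistent t) : InjOn (sweepKey t) {z | ¬ z.IsDiag} := by
  have eq_of_le : ∀ {i j i' j'}, i < j → i' < j' → j ≤ j' →
      sweepKey t s(i, j) = sweepKey t s(i', j') → s(i, j) = s(i', j') := by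
    intro i j i' j' hij hij' hjj' heq
    have heq_coord := congrFun heq j'
    simp only [sweepKey_mk t hij, sweepKey_mk t hij', lt_irrefl, if_false, if_true] at heq_coord
    rcases hjj'.eq_or_lt with rfl | hlt
    · by_contra hne
      refine ht.ne j i i' hij.ne' hij'.ne' (fun h => hne (h ▸ rfl)) ?_
      simpa using heq_coord
    · rw [if_pos hlt] at heq_coord
      split_ifs at heq_coord <;> simp at heq_coord
  intro z hz w hw heq
  obtain ⟨i, j, hij, rfl⟩ := exists_lt_eq_of_not_isDiag hz
  obtain ⟨i', j', hij', rfl⟩ := exists_lt_eq_of_not_isDiag hw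
  rcases le_total j j' with h | h
  · exact eq_of_le hij hij' h heq
  · exact (eq_of_le hij' hij h heq.symm).symm

end IsConsistent

/-- A left-to-right sweep over the crossings of an arrangement of `ℓ` pseudolines: `T` numbers the
crossings `s(i, j)` from `0` such that any three pseudolines cross one another in the same order as
three lines with slopes in the order of their labels. -/
structure IsSweep (T : Sym2 (Fin ℓ) → ℕ) : Prop where
  bijOn : BijOn T {z | ¬ z.IsDiag} (Iio (ℓ.choose 2))
  consistent : ∀ i j k, i < j → j < k →
    (T s(i, j) < T s(i, k) ∧ T s(i, k) < T s(j, k)) ∨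
      (T s(j, k) < T s(i, k) ∧ T s(i, k) < T s(i, j))

theorem IsConsistent.exists_isSweep {t : Fin ℓ → Fin ℓ → ℝ} (ht : IsConsistent t) :
    ∃ T : Sym2 (Fin ℓ) → ℕ, IsSweep T ∧
      ∀ i j k, i ≠ j → i ≠ k → (T s(i, j) < T s(i, k) ↔ t i j < t i k) := by
  classical
  let crossings : Finset (Sym2 (Fin ℓ)) := Finset.univ.filter fun z => ¬ z.IsDiag
  have mem_crossings : ∀ {i j}, i ≠ j → s(i, j) ∈ crossings := fun hij => by
    simpa [crossings] using hij
  have card_crossings : crossings.card = ℓ.choose 2 := by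
    rw [← Fintype.card_subtype, Sym2.card_subtype_not_diag, Fintype.card_fin]
  have coe_crossings : (crossings : Set (Sym2 (Fin ℓ))) = {z | ¬ z.IsDiag} := by
    simp [crossings]
  obtain ⟨T, hbij, hlt⟩ := exists_rank (s := crossings) (f := toColex ∘ sweepKey t)
    (toColex.injective.comp_injOn (coe_crossings ▸ ht.injOn_sweepKey))
  rw [card_crossings, coe_crossings] at hbij
  have consistent : ∀ i j k, i < j → j < k →
      if t i j < t i k then T s(i, j) < T s(i, k) ∧ T s(i, k) < T s(j, k)
      else T s(j, k) < T s(i, k) ∧ T s(i, k) < T s(i, j) := by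
    intro i j k hij hjk
    rw [hlt _ (mem_crossings hij.ne), hlt _ (mem_crossings hjk.ne),
      hlt _ (mem_crossings (hij.trans hjk).ne), hlt _ (mem_crossings (hij.trans hjk).ne)]
    split_ifs with h
    · exact ht.sweepKey_lt hij hjk h
    · exact ht.sweepKey_gt hij hjk
        ((not_lt.1 h).lt_of_ne (ht.ne i j k hij.ne (hij.trans hjk).ne hjk.ne).symm)
  refine ⟨T, ⟨hbij, fun i j k hij hjk => by grind⟩, fun i j k hij hik => ?_⟩
  rcases eq_or_ne j k with rfl | hjk
  · simp only [lt_self_iff_false]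
  have := ht.ne i j k hij hik hjk
  have swap : ∀ i j : Fin ℓ, s(i, j) = s(j, i) := fun _ _ => Sym2.eq_swap
  rcases hij.lt_or_gt with hij | hij <;> rcases hik.lt_or_gt with hik | hik <;>
    rcases hjk.lt_or_gt with hjk | hjk <;> grind [ht.lt_iff_left, ht.lt_iff_right]

end Sweep

section Wiring

variable {ℓ : ℕ} {T : Sym2 (Fin ℓ) → ℕ}

/-- At time `x` of a sweep, just before the crossing number `x`, the pseudoline `k` is below the
pseudoline `i`. -/
def IsBelow (T : Sym2 (Fin ℓ) → ℕ) (x : ℕ) (k i : Fin ℓ) : Prop :=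
  k ≠ i ∧ (k < i ↔ x ≤ T s(k, i))

open Classical in
/-- The pseudolines below the pseudoline `i` at time `x` of a sweep. -/
noncomputable def below (T : Sym2 (Fin ℓ) → ℕ) (x : ℕ) (i : Fin ℓ) : Finset (Fin ℓ) :=
  Finset.univ.filter fun k => IsBelow T x k i

theorem mem_below {x : ℕ} {k i : Fin ℓ} : k ∈ below T x i ↔ IsBelow T x k i := by
  simp [below]

theorem notMem_below_self (T : Sym2 (Fin ℓ) → ℕ) (x : ℕ) (i : Fin ℓ) : i ∉ below T x i :=
  fun h => (mem_below.1 h).1 rfl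

/-- The track of the pseudoline `i` at time `x` of a sweep. -/
noncomputable def sweepTrack (T : Sym2 (Fin ℓ) → ℕ) (x : ℕ) (i : Fin ℓ) : Fin ℓ :=
  ⟨(below T x i).card,
    (Finset.card_lt_univ_of_notMem (notMem_below_self T x i)).trans_eq (Fintype.card_fin ℓ)⟩

theorem sweepTrack_zero (T : Sym2 (Fin ℓ) → ℕ) (i : Fin ℓ) : sweepTrack T 0 i = i := by
  have below_zero : below T 0 i = Finset.Iio i := by
    ext k
    rw [mem_below, Finset.mem_Iio]
    grind [IsBelow]
  exact Fin.ext ((congrArg Finset.card below_zero).trans (Fin.card_Iio i))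

theorem isBelow_succ_iff {x : ℕ} {k i : Fin ℓ} (h : k ≠ i → T s(k, i) ≠ x) :
    IsBelow T (x + 1) k i ↔ IsBelow T x k i := by
  grind [IsBelow]

theorem sweepTrack_succ_of_forall_ne {x : ℕ} {i : Fin ℓ} (h : ∀ k ≠ i, T s(k, i) ≠ x) :
    sweepTrack T (x + 1) i = sweepTrack T x i := by
  have below_succ : below T (x + 1) i = below T x i := by
    ext k
    rw [mem_below, mem_below, isBelow_succ_iff (h k)]
  exact Fin.ext (congrArg Finset.card below_succ)

namespace IsSweep

theorem exists_lt_eq (hT : IsSweep T) {x : ℕ} (hx : x < ℓ.choose 2) :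
    ∃ i j, i < j ∧ T s(i, j) = x := by
  obtain ⟨z, hz, rfl⟩ := hT.bijOn.surjOn hx
  obtain ⟨i, j, hij, rfl⟩ := exists_lt_eq_of_not_isDiag hz
  exact ⟨i, j, hij, rfl⟩

theorem not_isBelow_cycle_of_lt (hT : IsSweep T) {x : ℕ} {i j k : Fin ℓ} (hij : i < j) (hik : i < k)
    (hBij : IsBelow T x i j) (hBjk : IsBelow T x j k) : ¬ IsBelow T x k i := by
  have hswap : s(j, k) = s(k, j) := Sym2.eq_swap
  have hswap' : s(k, i) = s(i, k) := Sym2.eq_swap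
  rcases hBjk.1.lt_or_gt with hjk | hkj
  · have := hT.consistent i j k hij hjk
    grind [IsBelow]
  · have := hT.consistent i k j hik hkj
    grind [IsBelow]

theorem isStrictTotalOrder_isBelow (hT : IsSweep T) (x : ℕ) :
    IsStrictTotalOrder (Fin ℓ) (IsBelow T x) := by
  refine isStrictTotalOrder_of_forall_not_cycle (fun i h => h.1 rfl) (fun i j hij => ?_) ?_
  · have hswap : s(j, i) = s(i, j) := Sym2.eq_swap
    grind [IsBelow]
  · intro i j k hij hjk hki
    rcases hij.1.lt_or_gt with h | h <;> rcases hjk.1.lt_or_gt with h' | h' <;>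
      rcases hki.1.lt_or_gt with h'' | h''
    all_goals grind [hT.not_isBelow_cycle_of_lt]

theorem sweepTrack_injective (hT : IsSweep T) (x : ℕ) : Function.Injective (sweepTrack T x) := by
  have := hT.isStrictTotalOrder_isBelow x
  have lt_of_isBelow : ∀ {i j}, IsBelow T x i j → sweepTrack T x i < sweepTrack T x j := by
    intro i j hij
    refine Fin.mk_lt_mk.2 (Finset.card_lt_card ((Finset.ssubset_iff_of_subset fun k hk => ?_).2
      ⟨i, mem_below.2 hij, notMem_below_self T x i⟩))
    exact mem_below.2 (_root_.trans (mem_below.1 hk) hij)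
  intro i j h
  rcases trichotomous_of (IsBelow T x) i j with hij | rfl | hji
  · exact absurd h (lt_of_isBelow hij).ne
  · rfl
  · exact absurd h (lt_of_isBelow hji).ne'

theorem isBelow_left_iff_right (hT : IsSweep T) {i j k : Fin ℓ} (hij : i < j) (hki : k ≠ i)
    (hkj : k ≠ j) : IsBelow T (T s(i, j)) k i ↔ IsBelow T (T s(i, j)) k j := by
  have hswap : ∀ a b : Fin ℓ, s(a, b) = s(b, a) := fun _ _ => Sym2.eq_swap
  rcases hki.lt_or_gt with h | h <;> rcases hkj.lt_or_gt with h' | h'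
  · grind [IsBelow, hT.consistent k i j h hij]
  · exact absurd (h'.trans h) hij.not_gt
  · grind [IsBelow, hT.consistent i k j h h']
  · grind [IsBelow, hT.consistent i j k hij h']

theorem below_right (hT : IsSweep T) {i j : Fin ℓ} (hij : i < j) :
    below T (T s(i, j)) j = insert i (below T (T s(i, j)) i) := by
  ext k
  simp only [Finset.mem_insert, mem_below]
  rcases eq_or_ne k i with rfl | hki
  · simp [IsBelow, hij, hij.ne]
  rcases eq_or_ne k j with rfl | hkj
  · have hswap : s(k, i) = s(i, k) := Sym2.eq_swap
    grind [IsBelow]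
  · simp only [hki, false_or, hT.isBelow_left_iff_right hij hki hkj]

theorem sweepTrack_right (hT : IsSweep T) {i j : Fin ℓ} (hij : i < j) :
    (sweepTrack T (T s(i, j)) j : ℕ) = sweepTrack T (T s(i, j)) i + 1 :=
  (congrArg Finset.card (hT.below_right hij)).trans
    (Finset.card_insert_of_notMem (notMem_below_self T _ i))

theorem ne_of_ne (hT : IsSweep T) {i j k l : Fin ℓ} (hij : i ≠ j) (hki : k ≠ i) (hkj : k ≠ j)
    (hkl : k ≠ l) : T s(k, l) ≠ T s(i, j) := fun h => by
  have := hT.bijOn.injOn (Sym2.mk_isDiag_iff.not.2 hkl) (Sym2.mk_isDiag_iff.not.2 hij) h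
  grind [Sym2.eq_iff]

theorem below_succ_left (hT : IsSweep T) {i j : Fin ℓ} (hij : i < j) :
    below T (T s(i, j) + 1) i = insert j (below T (T s(i, j)) i) := by
  ext k
  simp only [Finset.mem_insert, mem_below]
  rcases eq_or_ne k j with rfl | hkj
  · simp [IsBelow, hij.ne', hij.not_gt, Sym2.eq_swap (a := k)]
  rcases eq_or_ne k i with rfl | hki
  · simp [IsBelow, hkj]
  · simp only [hkj, false_or, isBelow_succ_iff (hT.ne_of_ne hij.ne hki hkj)]

theorem below_succ_right (hT : IsSweep T) {i j : Fin ℓ} (hij : i < j) :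
    below T (T s(i, j) + 1) j = below T (T s(i, j)) i := by
  ext k
  simp only [mem_below]
  rcases eq_or_ne k i with rfl | hki
  · simp [IsBelow, hij]
  rcases eq_or_ne k j with rfl | hkj
  · simp [IsBelow, hij.not_gt, Sym2.eq_swap (a := k)]
  · rw [isBelow_succ_iff (hT.ne_of_ne hij.ne hki hkj), hT.isBelow_left_iff_right hij hki hkj]

theorem sweepTrack_succ (hT : IsSweep T) {i j : Fin ℓ} (hij : i ≠ j) (k : Fin ℓ) :
    sweepTrack T (T s(i, j) + 1) k = sweepTrack T (T s(i, j)) (Equiv.swap i j k) := by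
  wlog hlt : i < j generalizing i j
  · rw [Sym2.eq_swap, Equiv.swap_comm]
    exact this hij.symm (hij.lt_or_gt.resolve_left hlt)
  rcases eq_or_ne k i with rfl | hki
  · rw [Equiv.swap_apply_left]
    refine Fin.ext ((congrArg Finset.card (hT.below_succ_left hlt)).trans ?_)
    rw [Finset.card_insert_of_notMem]
    · exact (hT.sweepTrack_right hlt).symm
    · simp [mem_below, IsBelow, hlt.not_gt, Sym2.eq_swap (a := j)]
  rcases eq_or_ne k j with rfl | hkj
  · rw [Equiv.swap_apply_right]
    exact Fin.ext (congrArg Finset.card (hT.below_succ_right hlt))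
  · rw [Equiv.swap_apply_of_ne_of_ne hki hkj]
    refine sweepTrack_succ_of_forall_ne fun l hl => ?_
    rw [Sym2.eq_swap]
    exact hT.ne_of_ne hij hki hkj hl.symm

end IsSweep

/-- The crossing number `x` of the sweep `T` takes place in the level `lev x`. -/
def IsLevelSequence (T : Sym2 (Fin ℓ) → ℕ) (lev : Fin (ℓ.choose 2) → Fin (ℓ - 1)) : Prop :=
  ∀ (x : Fin (ℓ.choose 2)) i j, i < j → T s(i, j) = x →
    sweepTrack T x i = lowerTrack (lev x) ∧ sweepTrack T x j = upperTrack (lev x)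

theorem IsSweep.exists_isLevelSequence (hT : IsSweep T) : ∃ lev, IsLevelSequence T lev := by
  have exists_level : ∀ x : Fin (ℓ.choose 2), ∃ t : Fin (ℓ - 1), ∀ i j, i < j → T s(i, j) = x →
      sweepTrack T x i = lowerTrack t ∧ sweepTrack T x j = upperTrack t := by
    intro x
    obtain ⟨i, j, hij, hx⟩ := hT.exists_lt_eq x.2
    have hright := hT.sweepTrack_right hij
    rw [hx] at hright
    refine ⟨⟨sweepTrack T x i, by omega⟩, fun i' j' hij' hx' => ?_⟩
    obtain ⟨rfl, rfl⟩ : i' = i ∧ j' = j := by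
      have := hT.bijOn.injOn (Sym2.mk_isDiag_iff.not.2 hij'.ne) (Sym2.mk_isDiag_iff.not.2 hij.ne)
        (hx'.trans hx.symm)
      grind [Sym2.eq_iff]
    exact ⟨rfl, Fin.ext hright⟩
  choose lev hlev using exists_level
  exact ⟨lev, hlev⟩

namespace IsLevelSequence

variable {lev : Fin (ℓ.choose 2) → Fin (ℓ - 1)}

theorem trackOccupant_sweepTrack (hlev : IsLevelSequence T lev) (hT : IsSweep T) {x : ℕ}
    (hx : x ≤ ℓ.choose 2) (i : Fin ℓ) :
    trackOccupant ((List.ofFn lev).take x) (sweepTrack T x i) = i := by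
  induction x generalizing i with
  | zero => simp [trackOccupant, sweepTrack_zero]
  | succ x ih =>
    obtain ⟨a, b, hab, hx'⟩ := hT.exists_lt_eq hx
    obtain ⟨hlower, hupper⟩ := hlev ⟨x, hx⟩ a b hab hx'
    have hsucc := hT.sweepTrack_succ hab.ne i
    simp only [hx'] at hlower hupper hsucc
    have trackOccupant_succ : trackOccupant ((List.ofFn lev).take (x + 1)) =
        trackOccupant ((List.ofFn lev).take x) *
          Equiv.swap (lowerTrack (lev ⟨x, hx⟩)) (upperTrack (lev ⟨x, hx⟩)) := by
      rw [List.take_succ_eq_append_getElem (by simpa using hx)]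
      simp [trackOccupant]
    rw [trackOccupant_succ, ← hlower, ← hupper, Equiv.Perm.mul_apply, hsucc,
      (hT.sweepTrack_injective x).swap_apply, Equiv.swap_apply_self]
    exact ih (by omega) i

theorem crossingPair_eq (hlev : IsLevelSequence T lev) (hT : IsSweep T)
    (x : Fin (List.ofFn lev).length) {i j : Fin ℓ} (hij : i ≠ j) (hx : T s(i, j) = x) :
    crossingPair (List.ofFn lev) x = s(i, j) := by
  wlog hlt : i < j generalizing i j
  · rw [Sym2.eq_swap] at hx ⊢
    exact this hij.symm hx (hij.lt_or_gt.resolve_left hlt)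
  have hxlt : (x : ℕ) < ℓ.choose 2 := x.2.trans_eq (List.length_ofFn)
  obtain ⟨hlower, hupper⟩ := hlev ⟨x, hxlt⟩ i j hlt hx
  rw [crossingPair, List.get_ofFn]
  change s(trackOccupant _ (lowerTrack (lev ⟨x, hxlt⟩)),
    trackOccupant _ (upperTrack (lev ⟨x, hxlt⟩))) = _
  rw [← hlower, ← hupper, hlev.trackOccupant_sweepTrack hT hxlt.le,
    hlev.trackOccupant_sweepTrack hT hxlt.le]

/-- The wiring diagram swept out by `T`. -/
def wiringDiagram (hlev : IsLevelSequence T lev) (hT : IsSweep T) : WiringDiagram ℓ where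
  levels := List.ofFn lev
  cross_once i j hij := by
    have hlt : T s(i, j) < (List.ofFn lev).length := by
      rw [List.length_ofFn]
      exact hT.bijOn.mapsTo (Sym2.mk_isDiag_iff.not.2 hij)
    refine ⟨⟨T s(i, j), hlt⟩, hlev.crossingPair_eq hT _ hij rfl, fun x hx => Fin.ext ?_⟩
    obtain ⟨a, b, hab, hxab⟩ := hT.exists_lt_eq (x.2.trans_eq List.length_ofFn)
    change crossingPair (List.ofFn lev) x = s(i, j) at hx
    exact hxab.symm.trans (congrArg T ((hlev.crossingPair_eq hT x hab.ne hxab).symm.trans hx))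

theorem card_filter_le_kappaMax (hlev : IsLevelSequence T lev) (hT : IsSweep T) (t : Fin (ℓ - 1)) :
    (Finset.univ.filter fun x => lev x = t).card ≤ kappaMax ℓ := by
  calc (Finset.univ.filter fun x => lev x = t).card
      = (hlev.wiringDiagram hT).levels.count t := by
        simpa [wiringDiagram, List.Vector.toList_ofFn] using
          Fin.card_filter_univ_eq_vector_get_eq_count t (List.Vector.ofFn lev)
    _ ≤ (hlev.wiringDiagram hT).complexity :=
        Finset.le_sup (f := fun t => (hlev.wiringDiagram hT).levels.count t) (Finset.mem_univ t)
    _ ≤ kappaMax ℓ := le_ciSup (bddAbove_complexity ℓ) _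

theorem level_eq_or_add_one_eq_iff (hlev : IsLevelSequence T lev) (hT : IsSweep T)
    (x : Fin (ℓ.choose 2)) (i : Fin ℓ) :
    (lev x : ℕ) = sweepTrack T x i ∨ (lev x + 1 : ℕ) = sweepTrack T x i ↔
      ∃ a ≠ i, T s(i, a) = x := by
  obtain ⟨a, b, hab, hx⟩ := hT.exists_lt_eq x.2
  have mem_iff : (∃ c ≠ i, T s(i, c) = x) ↔ i = a ∨ i = b := by
    refine ⟨fun ⟨c, hc, hxc⟩ => ?_, ?_⟩
    · by_contra! hi
      exact hT.ne_of_ne hab.ne hi.1 hi.2 hc.symm (hxc.trans hx.symm)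
    · rintro (rfl | rfl)
      · exact ⟨b, hab.ne', hx⟩
      · exact ⟨a, hab.ne, Sym2.eq_swap ▸ hx⟩
  obtain ⟨hlower, hupper⟩ := hlev x a b hab hx
  rw [mem_iff, ← (hT.sweepTrack_injective x).eq_iff, ← (hT.sweepTrack_injective x).eq_iff (b := b),
    hlower, hupper, Fin.ext_iff, Fin.ext_iff]
  exact or_congr eq_comm eq_comm

end IsLevelSequence

/-- Two crossings `x` and `y`, of the levels `lev x` and `lev y`, are joined along the track `τ`, on
which no crossing takes place between them. -/
structure IsTrackEdge {κ : Type*} [LinearOrder κ] (lev : κ → ℕ) (x y : κ) (τ : ℕ) : Prop where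
  ne : x ≠ y
  left : lev x = τ ∨ lev x + 1 = τ
  right : lev y = τ ∨ lev y + 1 = τ
  between : ∀ u ∈ uIoo x y, ¬ (lev u = τ ∨ lev u + 1 = τ)

theorem IsTrackEdge.symm {κ : Type*} [LinearOrder κ] {lev : κ → ℕ} {x y : κ} {τ : ℕ}
    (h : IsTrackEdge lev x y τ) : IsTrackEdge lev y x τ :=
  ⟨h.ne.symm, h.right, h.left, uIoo_comm x y ▸ h.between⟩

theorem sweepTrack_eq_of_forall_notMem {i : Fin ℓ} {x y : ℕ} (h : ∀ c ≠ i, T s(i, c) ∉ Ioo x y) :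
    ∀ u ∈ Ioc x y, sweepTrack T u i = sweepTrack T (x + 1) i := by
  rintro u ⟨hxu, huy⟩
  induction u, hxu using Nat.le_induction with
  | base => rfl
  | succ u hxu ih =>
    rw [sweepTrack_succ_of_forall_ne, ih (by omega)]
    rintro c hc rfl
    exact h c hc ⟨Sym2.eq_swap ▸ hxu, Sym2.eq_swap ▸ huy⟩

theorem IsLevelSequence.exists_isTrackEdge {lev : Fin (ℓ.choose 2) → Fin (ℓ - 1)}
    (hlev : IsLevelSequence T lev) (hT : IsSweep T) {x y : Fin (ℓ.choose 2)} (hne : x ≠ y)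
    {i a b : Fin ℓ} (ha : a ≠ i) (hb : b ≠ i) (hx : T s(i, a) = x) (hy : T s(i, b) = y)
    (hbetween : ∀ c ≠ i, T s(i, c) ∉ uIoo (x : ℕ) y) :
    ∃ τ, IsTrackEdge (fun u => (lev u : ℕ)) x y τ := by
  wlog hxy : x < y generalizing x y a b
  · obtain ⟨τ, hτ⟩ := this hne.symm hb ha hy hx (by rwa [uIoo_comm]) (hne.lt_or_gt.resolve_left hxy)
    exact ⟨τ, hτ.symm⟩
  rw [uIoo_of_lt (Fin.lt_def.1 hxy)] at hbetween
  have track_eq := sweepTrack_eq_of_forall_notMem hbetween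
  refine ⟨sweepTrack T (x + 1) i, hne, ?_, ?_, fun u hu => ?_⟩
  · have track_succ : sweepTrack T (x + 1) i = sweepTrack T x a := by
      rw [← hx, hT.sweepTrack_succ ha.symm, Equiv.swap_apply_left]
    rw [track_succ]
    exact (hlev.level_eq_or_add_one_eq_iff hT x a).2 ⟨i, ha.symm, Sym2.eq_swap ▸ hx⟩
  · rw [← track_eq y (right_mem_Ioc.2 hxy)]
    exact (hlev.level_eq_or_add_one_eq_iff hT y i).2 ⟨b, hb, hy⟩
  · rw [uIoo_of_lt hxy] at hu
    rw [← track_eq u ⟨hu.1, hu.2.le⟩, hlev.level_eq_or_add_one_eq_iff hT]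
    rintro ⟨c, hc, hcu⟩
    exact hbetween c hc (hcu ▸ hu)

end Wiring

section Levels

variable {ℓ : ℕ} {L : Fin ℓ → Set (ℝ × ℝ)}

theorem IsDirectedArrangement.exists_level {h : Fin ℓ → (ℝ × ℝ) ≃ₜ (ℝ × ℝ)}
    {t : Fin ℓ → Fin ℓ → ℝ} (hd : IsDirectedArrangement L h t) :
    ∃ (lev : Fin (ℓ.choose 2) → Fin (ℓ - 1)) (s : crossingPoints L ≃ Fin (ℓ.choose 2)),
      (∀ t, (Finset.univ.filter fun x => lev x = t).card ≤ kappaMax ℓ) ∧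
        ∀ p q, (arrangementGraph L).Adj p q →
          ∃ τ, IsTrackEdge (fun u => (lev u : ℕ)) (s p) (s q) τ := by
  obtain ⟨T, hT, hTt⟩ := hd.toIsConsistent.exists_isSweep
  obtain ⟨lev, hlev⟩ := hT.exists_isLevelSequence
  obtain ⟨c, hc⟩ := hd.toIsSimpleArrangement.exists_equiv_crossingPoints
  let s : crossingPoints L ≃ Fin (ℓ.choose 2) :=
    c.trans (hT.bijOn.equiv.trans Fin.equivSubtype.symm)
  refine ⟨lev, s, hlev.card_filter_le_kappaMax hT, fun p q hpq => ?_⟩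
  obtain ⟨i, hpi, hqi, hbetween⟩ := hd.toIsParametrization.exists_of_adj hpq
  have crosses : ∀ p : crossingPoints L, ↑p ∈ L i →
      ∃ a ≠ i, T s(i, a) = s p ∧ t i a = ((h i).symm p).1 := by
    intro p hp
    obtain ⟨a, ha, hpa⟩ : ∃ a ≠ i, ↑p ∈ L a := by
      obtain ⟨k, l, hkl, hk, hl⟩ := p.2
      grind
    refine ⟨a, ha, congrArg T (hc p i a ha.symm hp hpa).symm, ?_⟩
    rw [← (hd.mem_iff i a ha.symm _).1 ((hd.apply_fst_symm hp).symm ▸ hpa)]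
  obtain ⟨a, ha, hap, hta⟩ := crosses p hpi
  obtain ⟨b, hb, hbq, htb⟩ := crosses q hqi
  have hlt : ∀ j k, j ≠ i → k ≠ i → (t i j < t i k ↔ T s(i, j) < T s(i, k)) :=
    fun j k hj hk => (hTt i j k hj.symm hk.symm).symm
  refine hlev.exists_isTrackEdge hT (s.injective.ne hpq.ne) ha hb hap hbq fun k hk hmem =>
    hbetween k hk ?_
  rw [← hta, ← htb]
  simpa only [uIoo, mem_Ioo, inf_lt_iff, lt_sup_iff, hlt _ _ ha hk, hlt _ _ hb hk, hlt _ _ hk ha,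
    hlt _ _ hk hb, hap, hbq] using hmem

theorem IsSimpleArrangement.exists_level (hL : IsSimpleArrangement L) :
    ∃ (lev : Fin (ℓ.choose 2) → Fin (ℓ - 1)) (s : crossingPoints L ≃ Fin (ℓ.choose 2)),
      (∀ t, (Finset.univ.filter fun x => lev x = t).card ≤ kappaMax ℓ) ∧
        ∀ p q, (arrangementGraph L).Adj p q →
          ∃ τ, IsTrackEdge (fun u => (lev u : ℕ)) (s p) (s q) τ := by
  obtain ⟨e, h, t, hd⟩ := hL.exists_isDirectedArrangement
  obtain ⟨lev, s, hkappa, hadj⟩ := hd.exists_level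
  obtain ⟨φ⟩ := nonempty_arrangementGraph_comp_equiv_iso L e
  exact ⟨lev, φ.symm.toEquiv.trans s, hkappa, fun p q hpq => hadj _ _ (φ.symm.map_rel_iff.2 hpq)⟩

end Levels

section Drawing

theorem disjoint_openSegment_of_le {a b a' b' : ℝ × ℝ} (ha : a.2 = a'.2) (hb : b.2 = b'.2)
    (hab : a.2 ≠ b.2) (ha_le : a.1 ≤ a'.1) (hb_le : b.1 ≤ b'.1)
    (hlt : a.1 < a'.1 ∨ b.1 < b'.1) : Disjoint (openSegment ℝ a b) (openSegment ℝ a' b') := by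
  rw [disjoint_left]
  rintro p ⟨u, v, hu, hv, huv, rfl⟩ ⟨u', v', -, -, huv', heq⟩
  obtain ⟨hfst, hsnd⟩ := Prod.ext_iff.1 heq
  simp only [Prod.fst_add, Prod.snd_add, Prod.smul_fst, Prod.smul_snd, smul_eq_mul] at hfst hsnd
  have hv_eq : v' = v := by
    rw [← ha, ← hb, ← sub_eq_zero] at hsnd
    refine sub_eq_zero.1 ((mul_eq_zero.1 ?_).resolve_right (sub_ne_zero.2 hab.symm))
    linear_combination hsnd - a.2 * (huv' - huv)
  obtain rfl : u' = u := by linarith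
  subst hv_eq
  have : u' * a.1 + v' * b.1 < u' * a'.1 + v' * b'.1 := by
    rcases hlt with hlt | hlt
    · exact add_lt_add_of_lt_of_le (mul_lt_mul_of_pos_left hlt hu)
        (mul_le_mul_of_nonneg_left hb_le hv.le)
    · exact add_lt_add_of_le_of_lt (mul_le_mul_of_nonneg_left ha_le hu.le)
        (mul_lt_mul_of_pos_left hlt hv)
  exact this.ne' hfst

variable {κ : Type*} [LinearOrder κ] {lev : κ → ℕ} {f : κ → ℝ × ℝ} {x y x' y' : κ} {τ τ' : ℕ}

/-- A placement of crossings in the plane, level by level: higher levels are placed in higher rows,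
and the crossings of a level from left to right. -/
structure IsLevelPlacement (lev : κ → ℕ) (f : κ → ℝ × ℝ) : Prop where
  fst_lt : ∀ x y, lev x = lev y → x < y → (f x).1 < (f y).1
  snd_lt_iff : ∀ x y, (f x).2 < (f y).2 ↔ lev x < lev y

theorem IsTrackEdge.le_of_lt_left (h : IsTrackEdge lev x y τ) {u : κ}
    (hu : lev u = τ ∨ lev u + 1 = τ) (hxu : x < u) : y ≤ u :=
  not_lt.1 fun huy => h.between u (mem_uIoo_of_lt hxu huy) hu

theorem IsTrackEdge.ge_of_left_lt (h : IsTrackEdge lev x y τ) {u : κ}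
    (hu : lev u = τ ∨ lev u + 1 = τ) (hux : u < x) : u ≤ y :=
  not_lt.1 fun hyu => h.between u (mem_uIoo_of_gt hyu hux) hu

namespace IsLevelPlacement

theorem snd_eq_iff (hf : IsLevelPlacement lev f) : (f x).2 = (f y).2 ↔ lev x = lev y := by
  grind [hf.snd_lt_iff x y, hf.snd_lt_iff y x]

theorem fst_le (hf : IsLevelPlacement lev f) (hlev : lev x = lev y) (hxy : x ≤ y) :
    (f x).1 ≤ (f y).1 := by
  rcases hxy.eq_or_lt with rfl | hlt
  · rfl
  · exact (hf.fst_lt x y hlev hlt).le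

theorem lt_of_fst_lt (hf : IsLevelPlacement lev f) (hlev : lev x = lev y)
    (hlt : (f x).1 < (f y).1) : x < y :=
  not_le.1 fun hyx => (hf.fst_le hlev.symm hyx).not_gt hlt

theorem injective (hf : IsLevelPlacement lev f) : Function.Injective f := by
  intro x y hxy
  have hlev := hf.snd_eq_iff.1 (congrArg Prod.snd hxy)
  rcases lt_trichotomy x y with hlt | rfl | hlt
  · exact absurd (congrArg Prod.fst hxy) (hf.fst_lt x y hlev hlt).ne
  · rfl
  · exact absurd (congrArg Prod.fst hxy) (hf.fst_lt y x hlev.symm hlt).ne'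

theorem snd_eq_of_mem_openSegment (hf : IsLevelPlacement lev f) (hlev : lev x = lev y) {p : ℝ × ℝ}
    (hp : p ∈ openSegment ℝ (f x) (f y)) : p.2 = (f x).2 := by
  have := (Prod.openSegment_subset _ _ hp).2
  rwa [← hf.snd_eq_iff.2 hlev, openSegment_same] at this

theorem fst_mem_of_mem_openSegment (hf : IsLevelPlacement lev f) (hlev : lev x = lev y)
    (hxy : x < y) {p : ℝ × ℝ} (hp : p ∈ openSegment ℝ (f x) (f y)) :
    p.1 ∈ Ioo (f x).1 (f y).1 := by
  rw [← openSegment_eq_Ioo (hf.fst_lt x y hlev hxy)]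
  exact (Prod.openSegment_subset _ _ hp).1

theorem snd_mem_of_mem_openSegment (hf : IsLevelPlacement lev f) (hlev : lev x < lev y) {p : ℝ × ℝ}
    (hp : p ∈ openSegment ℝ (f x) (f y)) : p.2 ∈ Ioo (f x).2 (f y).2 := by
  rw [← openSegment_eq_Ioo ((hf.snd_lt_iff x y).2 hlev)]
  exact (Prod.openSegment_subset _ _ hp).2

theorem notMem_openSegment (hf : IsLevelPlacement lev f) (hxy : IsTrackEdge lev x y τ) (w : κ) :
    f w ∉ openSegment ℝ (f x) (f y) := by
  intro hw
  wlog hle : lev x ≤ lev y generalizing x y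
  · exact this hxy.symm (openSegment_symm ℝ (f x) (f y) ▸ hw) (le_of_not_ge hle)
  rcases hle.eq_or_lt with heq | hlt
  · wlog hlt : x < y generalizing x y
    · exact this hxy.symm (openSegment_symm ℝ (f x) (f y) ▸ hw) heq.ge heq.symm
        (hxy.ne.lt_or_gt.resolve_left hlt)
    have hlev : lev w = lev x := hf.snd_eq_iff.1 (hf.snd_eq_of_mem_openSegment heq hw)
    obtain ⟨hxw, hwy⟩ := hf.fst_mem_of_mem_openSegment heq hlt hw
    refine hxy.between w ?_ (hlev ▸ hxy.left)
    rw [uIoo_of_lt hlt]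
    exact ⟨hf.lt_of_fst_lt hlev.symm hxw, hf.lt_of_fst_lt (hlev.trans heq) hwy⟩
  · obtain ⟨hxw, hwy⟩ := hf.snd_mem_of_mem_openSegment hlt hw
    rw [hf.snd_lt_iff] at hxw hwy
    grind [hxy.left, hxy.right]

theorem disjoint_of_level_eq (hf : IsLevelPlacement lev f) (hxy : IsTrackEdge lev x y τ)
    (hxy' : IsTrackEdge lev x' y' τ') (hne : s(x, y) ≠ s(x', y')) (hlev : lev x = lev y)
    (hlev' : lev x' = lev y') :
    Disjoint (openSegment ℝ (f x) (f y)) (openSegment ℝ (f x') (f y')) := by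
  wlog hlt : x < y generalizing x y
  · rw [openSegment_symm]
    exact this hxy.symm (by rwa [Sym2.eq_swap (a := y)]) hlev.symm
      (hxy.ne.lt_or_gt.resolve_left hlt)
  wlog hlt' : x' < y' generalizing x' y'
  · rw [openSegment_symm ℝ (f x')]
    exact this hxy'.symm hlev'.symm (by rwa [Sym2.eq_swap (a := y')])
      (hxy'.ne.lt_or_gt.resolve_left hlt')
  rw [disjoint_left]
  intro p hp hp'
  have hlev_eq : lev x = lev x' := hf.snd_eq_iff.1 <|
    (hf.snd_eq_of_mem_openSegment hlev hp).symm.trans (hf.snd_eq_of_mem_openSegment hlev' hp')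
  obtain ⟨hxp, hpy⟩ := hf.fst_mem_of_mem_openSegment hlev hlt hp
  obtain ⟨hxp', hpy'⟩ := hf.fst_mem_of_mem_openSegment hlev' hlt' hp'
  have hxy'_lt : x < y' := hf.lt_of_fst_lt (hlev_eq.trans hlev') (hxp.trans hpy')
  have hx'y_lt : x' < y := hf.lt_of_fst_lt (hlev_eq.symm.trans hlev) (hxp'.trans hpy)
  have hx : x = x' := le_antisymm
    (not_lt.1 fun hlt => (hxy'.le_of_lt_left (hlev_eq ▸ hxy'.left) hlt).not_gt hxy'_lt)
    (not_lt.1 fun hlt => (hxy.le_of_lt_left (hlev_eq ▸ hxy.left) hlt).not_gt hx'y_lt)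
  have hy : y = y' := le_antisymm
    (not_lt.1 fun hlt => (hxy.symm.ge_of_left_lt (hlev' ▸ hlev_eq ▸ hxy.left) hlt).not_gt hxy'_lt)
    (not_lt.1 fun hlt =>
      (hxy'.symm.ge_of_left_lt (hlev ▸ hlev_eq.symm ▸ hxy'.left) hlt).not_gt hx'y_lt)
  exact hne (by rw [hx, hy])

theorem disjoint_of_level_eq_of_level_lt (hf : IsLevelPlacement lev f)
    (hxy' : IsTrackEdge lev x' y' τ') (hlev : lev x = lev y) (hlev' : lev x' < lev y') :
    Disjoint (openSegment ℝ (f x) (f y)) (openSegment ℝ (f x') (f y')) := by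
  rw [disjoint_left]
  intro p hp hp'
  have hbetween := hf.snd_mem_of_mem_openSegment hlev' hp'
  rw [hf.snd_eq_of_mem_openSegment hlev hp, mem_Ioo, hf.snd_lt_iff, hf.snd_lt_iff] at hbetween
  grind [hxy'.left, hxy'.right]

theorem disjoint_of_le (hf : IsLevelPlacement lev f) (hlev_x : lev x = lev x')
    (hlev_y : lev y = lev y') (hlev : lev x ≠ lev y) (hne : s(x, y) ≠ s(x', y')) (hx : x ≤ x')
    (hy : y ≤ y') : Disjoint (openSegment ℝ (f x) (f y)) (openSegment ℝ (f x') (f y')) := by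
  refine disjoint_openSegment_of_le (hf.snd_eq_iff.2 hlev_x) (hf.snd_eq_iff.2 hlev_y)
    (hf.snd_eq_iff.not.2 hlev) (hf.fst_le hlev_x hx) (hf.fst_le hlev_y hy) ?_
  rcases hx.eq_or_lt with rfl | hx
  · exact Or.inr (hf.fst_lt y y' hlev_y (hy.lt_of_ne fun h => hne (h ▸ rfl)))
  · exact Or.inl (hf.fst_lt x x' hlev_x hx)

theorem disjoint_of_level_lt (hf : IsLevelPlacement lev f) (hxy : IsTrackEdge lev x y τ)
    (hxy' : IsTrackEdge lev x' y' τ') (hne : s(x, y) ≠ s(x', y')) (hlev : lev x < lev y)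
    (hlev' : lev x' < lev y') :
    Disjoint (openSegment ℝ (f x) (f y)) (openSegment ℝ (f x') (f y')) := by
  rw [disjoint_left]
  intro p hp hp'
  obtain ⟨hx_lt, hlt_y⟩ := hf.snd_mem_of_mem_openSegment hlev hp
  obtain ⟨hx'_lt, hlt_y'⟩ := hf.snd_mem_of_mem_openSegment hlev' hp'
  have hxy'_lt := (hf.snd_lt_iff x y').1 (hx_lt.trans hlt_y')
  have hx'y_lt := (hf.snd_lt_iff x' y).1 (hx'_lt.trans hlt_y)
  have hleft := hxy.left
  have hleft' := hxy'.left
  have hright := hxy.right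
  have hright' := hxy'.right
  obtain rfl : τ = τ' := by omega
  have hlev_x : lev x = lev x' := by omega
  have hlev_y : lev y = lev y' := by omega
  have same_order : x ≤ x' ∧ y ≤ y' ∨ x' ≤ x ∧ y' ≤ y := by
    have := hxy.symm.ge_of_left_lt hright'
    have := hxy'.symm.ge_of_left_lt hright
    have := hxy.ge_of_left_lt hleft'
    have := hxy'.ge_of_left_lt hleft
    grind
  rcases same_order with ⟨hx, hy⟩ | ⟨hx, hy⟩
  · exact disjoint_left.1 (hf.disjoint_of_le hlev_x hlev_y hlev.ne hne hx hy) hp hp'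
  · exact disjoint_left.1
      (hf.disjoint_of_le hlev_x.symm hlev_y.symm hlev'.ne hne.symm hx hy) hp' hp

theorem disjoint_openSegment (hf : IsLevelPlacement lev f) (hxy : IsTrackEdge lev x y τ)
    (hxy' : IsTrackEdge lev x' y' τ') (hne : s(x, y) ≠ s(x', y')) :
    Disjoint (openSegment ℝ (f x) (f y)) (openSegment ℝ (f x') (f y')) := by
  wlog hle : lev x ≤ lev y generalizing x y
  · rw [openSegment_symm]
    exact this hxy.symm (by rwa [Sym2.eq_swap (a := y)]) (le_of_not_ge hle)
  wlog hle' : lev x' ≤ lev y' generalizing x' y'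
  · rw [openSegment_symm ℝ (f x')]
    exact this hxy'.symm (by rwa [Sym2.eq_swap (a := y')]) (le_of_not_ge hle')
  rcases hle.eq_or_lt with heq | hlt <;> rcases hle'.eq_or_lt with heq' | hlt'
  · exact hf.disjoint_of_level_eq hxy hxy' hne heq heq'
  · exact hf.disjoint_of_level_eq_of_level_lt hxy' heq hlt'
  · exact (hf.disjoint_of_level_eq_of_level_lt hxy heq' hlt).symm
  · exact hf.disjoint_of_level_lt hxy hxy' hne hlt hlt'

theorem isPlanarStraightLineDrawing (hf : IsLevelPlacement lev f) {V : Type*} {G : SimpleGraph V}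
    {s : V → κ} (hs : Function.Injective s)
    (hadj : ∀ u v, G.Adj u v → ∃ τ, IsTrackEdge lev (s u) (s v) τ) :
    IsPlanarStraightLineDrawing G (f ∘ s) where
  injective := hf.injective.comp hs
  vertex_edge u v w huv hw := by
    obtain ⟨τ, hτ⟩ := hadj u v huv
    rw [← insert_endpoints_openSegment] at hw
    rcases hw with hwu | hwv | hw
    · exact Or.inl (hs (hf.injective hwu))
    · exact Or.inr (hs (hf.injective hwv))
    · exact absurd hw (hf.notMem_openSegment hτ (s w))
  edge_edge u v u' v' huv huv' hne := by
    obtain ⟨τ, hτ⟩ := hadj u v huv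
    obtain ⟨τ', hτ'⟩ := hadj u' v' huv'
    exact hf.disjoint_openSegment hτ hτ' ((Sym2.map.injective hs).ne hne)

end IsLevelPlacement

end Drawing

section XiSeq

theorem xiSeq_two_mul {i : ℕ} (hi : 0 < i) : xiSeq (2 * i) = 2 * xiSeq i + 1 := by
  have hdiv := Nat.xor_div_two (a := 2 * i) (b := 2 * i - 1)
  have hmod := Nat.xor_mod_two_eq (m := 2 * i) (n := 2 * i - 1)
  rw [Nat.mul_div_cancel_left i two_pos, show (2 * i - 1) / 2 = i - 1 by lia] at hdiv
  unfold xiSeq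
  lia

theorem xiSeq_two_mul_add_one (i : ℕ) : xiSeq (2 * i + 1) = 1 := by
  have hdiv := Nat.xor_div_two (a := 2 * i + 1) (b := 2 * i)
  have hmod := Nat.xor_mod_two_eq (m := 2 * i + 1) (n := 2 * i)
  rw [Nat.mul_div_cancel_left i two_pos, show (2 * i + 1) / 2 = i by lia, Nat.xor_self] at hdiv
  rw [xiSeq, Nat.add_sub_cancel]
  lia

theorem two_pow_le_xiSeq_add_one (k : ℕ) {m : ℕ} (hm : 0 < m) :
    2 ^ (k + 1) ≤ xiSeq (2 ^ k * m) + 1 := by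
  induction k with
  | zero =>
    rcases Nat.even_or_odd' m with ⟨j, rfl | rfl⟩
    · rw [pow_zero, one_mul, xiSeq_two_mul (by lia)]
      lia
    · rw [pow_zero, one_mul, xiSeq_two_mul_add_one, zero_add, pow_one]
  | succ k ih =>
    rw [pow_succ' 2 k, mul_assoc, xiSeq_two_mul (by positivity)]
    lia

theorem exists_le_xiSeq (a : ℕ) {d : ℕ} (hd : 0 < d) : ∃ i ∈ Ioc a (a + d), d ≤ xiSeq i := by
  set k := Nat.log 2 d
  have hk : 2 ^ k ≤ d := Nat.pow_log_le_self 2 hd.ne'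
  have hk_succ : d < 2 ^ (k + 1) := Nat.lt_pow_succ_log_self one_lt_two _
  refine ⟨2 ^ k * (a / 2 ^ k + 1), ⟨Nat.lt_mul_div_succ a (by positivity), ?_⟩, ?_⟩
  · rw [mul_add_one]
    exact add_le_add (Nat.mul_div_le _ _) hk
  · exact Nat.le_of_lt_succ (hk_succ.trans_le (two_pow_le_xiSeq_add_one k (Nat.succ_pos _)))

theorem exists_strictMono_le_xiSeq {d : ℕ → ℕ} (hd : ∀ t, 0 < d t) :
    ∃ row : ℕ → ℕ, StrictMono row ∧ ∀ t,
      row t ∈ Icc 1 (∑ r ∈ Finset.range (t + 1), d r) ∧ d t ≤ xiSeq (row t) := by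
  choose row hrow hxi using fun t => exists_le_xiSeq (∑ r ∈ Finset.range t, d r) (hd t)
  simp only [← Finset.sum_range_succ, mem_Ioc] at hrow
  exact ⟨row, strictMono_nat_of_lt_succ fun t => (hrow t).2.trans_lt (hrow (t + 1)).1,
    fun t => ⟨⟨(Nat.zero_le _).trans_lt (hrow t).1, (hrow t).2⟩, hxi t⟩⟩

theorem sum_xiSeq_two_mul (m : ℕ) :
    ∑ i ∈ Finset.Icc 1 (2 * m), xiSeq i = 2 * ∑ i ∈ Finset.Icc 1 m, xiSeq i + 2 * m := by
  induction m with
  | zero => rfl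
  | succ m ih =>
    rw [mul_add_one, Finset.sum_Icc_succ_top (by lia), Finset.sum_Icc_succ_top (by lia),
      Finset.sum_Icc_succ_top (by lia), ih, xiSeq_two_mul_add_one, add_assoc (2 * m),
      ← mul_add_one 2 m, xiSeq_two_mul (Nat.add_one_pos m)]
    ring

theorem sum_xiSeq_le (m : ℕ) :
    ∑ i ∈ Finset.Icc 1 m, xiSeq i ≤ m * (2 * Nat.log 2 m + 1) := by
  induction m using Nat.strong_induction_on with
  | _ m ih =>
    rcases Nat.even_or_odd' m with ⟨j, rfl | rfl⟩ <;> rcases Nat.eq_zero_or_pos j with rfl | hj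
    · rfl
    · rw [sum_xiSeq_two_mul, mul_comm 2 j, Nat.log_mul_base one_lt_two hj.ne']
      linarith [ih j (by lia)]
    · rfl
    · have hlog : Nat.log 2 j + 1 ≤ Nat.log 2 (2 * j + 1) := by
        rw [← Nat.log_mul_base one_lt_two hj.ne']
        exact Nat.log_mono_right (by lia)
      rw [Finset.sum_Icc_succ_top (by lia), sum_xiSeq_two_mul, xiSeq_two_mul_add_one]
      nlinarith [ih j (by lia)]

end XiSeq

section UniversalSet

/-- The universal point set for the graphs of simple arrangements of `ℓ` pseudolines. -/
noncomputable def arrangementPoints (ℓ : ℕ) : Finset (ℕ × ℕ) :=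
  (Finset.Icc 1 (kappaMax ℓ) ×ˢ Finset.Icc 1 (3 * (ℓ - 1) / 2)).filter
    fun p => p.1 ≤ ℓ * xiSeq p.2

theorem arrangementPoints_subset (ℓ : ℕ) :
    arrangementPoints ℓ ⊆ Finset.Icc 1 (kappaMax ℓ) ×ˢ Finset.Icc 1 (3 * (ℓ - 1) / 2) :=
  Finset.filter_subset _ _

theorem arrangementPoints_eq_empty {ℓ : ℕ} (hℓ : ℓ ≤ 1) : arrangementPoints ℓ = ∅ := by
  simp [arrangementPoints, Nat.sub_eq_zero_of_le hℓ]

theorem mem_arrangementPoints {ℓ : ℕ} {p : ℕ × ℕ} :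
    p ∈ arrangementPoints ℓ ↔ p.1 ∈ Finset.Icc 1 (min (ℓ * xiSeq p.2) (kappaMax ℓ)) ∧
      p.2 ∈ Finset.Icc 1 (3 * (ℓ - 1) / 2) := by
  simp only [arrangementPoints, Finset.mem_filter, Finset.mem_product, Finset.mem_Icc, le_min_iff]
  tauto

theorem card_filter_arrangementPoints {ℓ i : ℕ} (hi : i ∈ Finset.Icc 1 (3 * (ℓ - 1) / 2)) :
    ((arrangementPoints ℓ).filter fun p => p.2 = i).card = min (ℓ * xiSeq i) (kappaMax ℓ) := by
  have row_eq : (arrangementPoints ℓ).filter (fun p => p.2 = i) =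
      Finset.Icc 1 (min (ℓ * xiSeq i) (kappaMax ℓ)) ×ˢ {i} := by
    ext p
    simp only [Finset.mem_filter, mem_arrangementPoints, Finset.mem_product, Finset.mem_singleton]
    grind
  rw [row_eq, Finset.card_product, Finset.card_singleton, mul_one, Nat.card_Icc,
    Nat.add_sub_cancel]

theorem card_arrangementPoints_le (ℓ : ℕ) :
    (arrangementPoints ℓ).card ≤
      ℓ * (3 * (ℓ - 1) / 2 * (2 * Nat.log 2 (3 * (ℓ - 1) / 2) + 1)) := by
  set s := 3 * (ℓ - 1) / 2
  calc (arrangementPoints ℓ).card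
      = ∑ i ∈ Finset.Icc 1 s, ((arrangementPoints ℓ).filter fun p => p.2 = i).card :=
        Finset.card_eq_sum_card_fiberwise fun p hp => (mem_arrangementPoints.1 hp).2
    _ ≤ ∑ i ∈ Finset.Icc 1 s, ℓ * xiSeq i := Finset.sum_le_sum fun i hi =>
        (card_filter_arrangementPoints hi).trans_le (min_le_left _ _)
    _ = ℓ * ∑ i ∈ Finset.Icc 1 s, xiSeq i := (Finset.mul_sum ..).symm
    _ ≤ ℓ * (s * (2 * Nat.log 2 s + 1)) := Nat.mul_le_mul_left _ (sum_xiSeq_le s)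

/-- The number of pseudolines of a simple arrangement with `n` crossings: if `n = ℓ * (ℓ - 1) / 2`
and `0 < ℓ`, then the integer part of the square root of `2 * n` is `ℓ - 1`. -/
def numPseudolines (n : ℕ) : ℕ := Nat.sqrt (2 * n) + 1

theorem arrangementPoints_numPseudolines (ℓ : ℕ) :
    arrangementPoints (numPseudolines (ℓ * (ℓ - 1) / 2)) = arrangementPoints ℓ := by
  rcases ℓ with _ | m
  · exact (arrangementPoints_eq_empty le_rfl).trans (arrangementPoints_eq_empty zero_le_one).symm
  · rw [numPseudolines, Nat.mul_div_cancel' (Nat.even_mul_pred_self _).two_dvd,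
      Nat.add_sub_cancel, add_one_mul, Nat.sqrt_add_eq m (Nat.le_add_left m m)]

theorem card_arrangementPoints_numPseudolines_le (n : ℕ) :
    (arrangementPoints (numPseudolines n)).card ≤ 6 * n * (2 * Nat.log 2 (3 * n) + 1) := by
  set r := Nat.sqrt (2 * n)
  set s := 3 * r / 2
  have hr_sq : r * r ≤ 2 * n := Nat.sqrt_le _
  have hr : r ≤ 2 * n := Nat.sqrt_le_self _
  have hs : 2 * s ≤ 3 * r := Nat.mul_div_le _ _
  calc (arrangementPoints (numPseudolines n)).card
      ≤ (r + 1) * (s * (2 * Nat.log 2 s + 1)) := card_arrangementPoints_le (r + 1)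
    _ = (r + 1) * s * (2 * Nat.log 2 s + 1) := (mul_assoc _ _ _).symm
    _ ≤ 6 * n * (2 * Nat.log 2 (3 * n) + 1) := by
      refine Nat.mul_le_mul (by nlinarith) ?_
      gcongr
      lia

theorem card_arrangementPoints_isBigO :
    (fun n : ℕ => ((arrangementPoints (numPseudolines n)).card : ℝ)) =O[atTop]
      fun n : ℕ => (n : ℝ) * Real.log n := by
  refine IsBigO.of_bound (30 / Real.log 2) ?_
  filter_upwards [eventually_ge_atTop 3] with n hn
  have hlog_two : 0 < Real.log 2 := Real.log_pos one_lt_two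
  have hn3 : (3 : ℝ) ≤ n := mod_cast hn
  have hlog : Real.log 2 ≤ Real.log n := Real.log_le_log two_pos (by linarith)
  have hlog_three : Real.log 3 ≤ Real.log n := Real.log_le_log three_pos hn3
  have natLog_le : (Nat.log 2 (3 * n) : ℝ) ≤ 2 * Real.log n / Real.log 2 := by
    refine (Real.natLog_le_logb _ _).trans ?_
    rw [Real.logb, Nat.cast_ofNat, Nat.cast_mul, Nat.cast_ofNat,
      Real.log_mul three_ne_zero (by positivity)]
    gcongr
    linarith
  have one_le : 1 ≤ Real.log n / Real.log 2 := (one_le_div hlog_two).2 hlog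
  rw [Real.norm_of_nonneg (Nat.cast_nonneg _),
    Real.norm_of_nonneg (mul_nonneg (Nat.cast_nonneg _) (hlog_two.le.trans hlog))]
  calc ((arrangementPoints (numPseudolines n)).card : ℝ)
      ≤ 6 * n * (2 * Nat.log 2 (3 * n) + 1) := mod_cast card_arrangementPoints_numPseudolines_le n
    _ ≤ 6 * n * (2 * (2 * Real.log n / Real.log 2) + Real.log n / Real.log 2) := by gcongr
    _ = 30 / Real.log 2 * (n * Real.log n) := by ring

end UniversalSet

section Placement

theorem exists_row {ℓ : ℕ} {c : ℕ → ℕ} (hc : ∑ t ∈ Finset.range (ℓ - 1), c t ≤ ℓ.choose 2) :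
    ∃ row : ℕ → ℕ, StrictMono row ∧ ∀ t < ℓ - 1,
      row t ∈ Finset.Icc 1 (3 * (ℓ - 1) / 2) ∧ c t ≤ ℓ * xiSeq (row t) := by
  obtain ⟨row, hrow, hrow_mem⟩ := exists_strictMono_le_xiSeq (d := fun t => c t / ℓ + 1)
    fun t => Nat.succ_pos _
  refine ⟨row, hrow, fun t ht => ?_⟩
  have hℓ : 0 < ℓ := by lia
  obtain ⟨⟨hpos, hle⟩, hxi⟩ := hrow_mem t
  have sum_div_le : 2 * ∑ t ∈ Finset.range (ℓ - 1), c t / ℓ ≤ ℓ - 1 := by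
    refine Nat.le_of_mul_le_mul_left ?_ hℓ
    calc ℓ * (2 * ∑ t ∈ Finset.range (ℓ - 1), c t / ℓ)
        = 2 * ∑ t ∈ Finset.range (ℓ - 1), ℓ * (c t / ℓ) := by rw [← Finset.mul_sum]; ring
      _ ≤ 2 * ∑ t ∈ Finset.range (ℓ - 1), c t := by gcongr; exact Nat.mul_div_le _ _
      _ ≤ 2 * (ℓ * (ℓ - 1) / 2) := by rw [← Nat.choose_two_right]; gcongr
      _ ≤ ℓ * (ℓ - 1) := Nat.mul_div_le _ _
  have row_le : row t ≤ ∑ r ∈ Finset.range (ℓ - 1), c r / ℓ + (ℓ - 1) := by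
    refine hle.trans ((Finset.sum_le_sum_of_subset (Finset.range_mono ht)).trans_eq ?_)
    rw [Finset.sum_add_distrib, Finset.sum_const, Finset.card_range, smul_eq_mul, mul_one]
  refine ⟨Finset.mem_Icc.2 ⟨hpos, by lia⟩, ?_⟩
  exact (Nat.lt_mul_div_succ _ hℓ).le.trans (Nat.mul_le_mul_left _ hxi)

variable {κ : Type*} [LinearOrder κ] [Fintype κ]

/-- The grid position of the crossing `x`: its column is its rank among the crossings of its level,
and its row is determined by its level. -/
def levelPosition (lev : κ → ℕ) (row : ℕ → ℕ) (x : κ) : ℕ × ℕ :=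
  ((Finset.univ.filter fun u => u ≤ x ∧ lev u = lev x).card, row (lev x))

theorem isLevelPlacement_levelPosition (lev : κ → ℕ) {row : ℕ → ℕ} (hrow : StrictMono row) :
    IsLevelPlacement lev (gridPoint ∘ levelPosition lev row) where
  fst_lt x y hlev hlt := by
    refine Nat.cast_lt.2 (Finset.card_lt_card ((Finset.ssubset_iff_of_subset fun u => ?_).2
      ⟨y, ?_, ?_⟩)) <;> grind
  snd_lt_iff x y := Nat.cast_lt.trans hrow.lt_iff_lt

theorem levelPosition_fst_mem (lev : κ → ℕ) (row : ℕ → ℕ) (x : κ) :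
    (levelPosition lev row x).1 ∈
      Finset.Icc 1 (Finset.univ.filter fun u => lev u = lev x).card := by
  refine Finset.mem_Icc.2 ⟨Finset.card_pos.2 ⟨x, by simp⟩, Finset.card_le_card ?_⟩
  exact Finset.monotone_filter_right _ fun u _ hu => hu.2

theorem exists_isLevelPlacement_arrangementPoints {ℓ : ℕ} {lev : κ → ℕ}
    (hcard : Fintype.card κ ≤ ℓ.choose 2) (hlev : ∀ x, lev x < ℓ - 1)
    (hkappa : ∀ x, (Finset.univ.filter fun u => lev u = lev x).card ≤ kappaMax ℓ) :
    ∃ pos : κ → ℕ × ℕ, (∀ x, pos x ∈ arrangementPoints ℓ) ∧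
      IsLevelPlacement lev (gridPoint ∘ pos) := by
  have sum_card : ∑ t ∈ Finset.range (ℓ - 1), (Finset.univ.filter fun u => lev u = t).card =
      Fintype.card κ :=
    (Finset.card_eq_sum_card_fiberwise fun x _ => by simpa using hlev x).symm
  obtain ⟨row, hrow, hrow_mem⟩ := exists_row (sum_card.trans_le hcard)
  refine ⟨levelPosition lev row, fun x => mem_arrangementPoints.2 ⟨?_, (hrow_mem _ (hlev x)).1⟩,
    isLevelPlacement_levelPosition lev hrow⟩
  obtain ⟨hpos, hle⟩ := Finset.mem_Icc.1 (levelPosition_fst_mem lev row x)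
  exact Finset.mem_Icc.2
    ⟨hpos, le_min (hle.trans (hrow_mem _ (hlev x)).2) (hle.trans (hkappa x))⟩

end Placement

theorem IsSimpleArrangement.exists_drawing {ℓ : ℕ} {L : Fin ℓ → Set (ℝ × ℝ)}
    (hL : IsSimpleArrangement L) {V : Type*} {G : SimpleGraph V} (φ : G ≃g arrangementGraph L) :
    ∃ f : V → ℝ × ℝ, (∀ v, f v ∈ gridPoint '' (arrangementPoints ℓ : Set (ℕ × ℕ))) ∧
      IsPlanarStraightLineDrawing G f := by
  obtain ⟨lev, s, hkappa, hadj⟩ := hL.exists_level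
  obtain ⟨pos, hpos, hplacement⟩ := exists_isLevelPlacement_arrangementPoints
    (lev := fun u => (lev u : ℕ)) (Fintype.card_fin _).le (fun x => (lev x).2)
    fun x => by simpa only [Fin.val_inj] using hkappa (lev x)
  exact ⟨_, fun v => mem_image_of_mem _ (hpos (s (φ v))),
    hplacement.isPlanarStraightLineDrawing (s := fun v => s (φ v))
      (s.injective.comp φ.injective) fun u v huv => hadj _ _ (φ.map_rel_iff.2 huv)⟩

theorem IsSimpleArrangement.natCard_crossingPoints {ℓ : ℕ} {L : Fin ℓ → Set (ℝ × ℝ)}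
    (hL : IsSimpleArrangement L) :
    Nat.card (crossingPoints L) = ℓ * (ℓ - 1) / 2 := by
  obtain ⟨c, -⟩ := hL.exists_equiv_crossingPoints
  rw [Nat.card_congr c, Nat.card_eq_fintype_card, Sym2.card_subtype_not_diag, Fintype.card_fin,
    Nat.choose_two_right]

theorem mainTheorem2 :
    ∃ U : ℕ → Finset (ℕ × ℕ),
      (∀ n : ℕ, IsUniversalPointSet (n := n) IsArrangementGraph
        (gridPoint '' (U n : Set (ℕ × ℕ)))) ∧
      (fun n : ℕ => ((U n).card : ℝ)) =O[atTop] (fun n : ℕ => (n : ℝ) * Real.log n) ∧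
      ∀ n ℓ : ℕ, n = ℓ * (ℓ - 1) / 2 →
        U n ⊆ Finset.Icc 1 (kappaMax ℓ) ×ˢ Finset.Icc 1 (3 * (ℓ - 1) / 2) ∧
        ∀ i ∈ Finset.Icc 1 (3 * (ℓ - 1) / 2),
          ((U n).filter fun p => p.2 = i).card = min (ℓ * xiSeq i) (kappaMax ℓ) := by
  refine ⟨fun n => arrangementPoints (numPseudolines n), fun n G hG => ?_,
    card_arrangementPoints_isBigO, ?_⟩
  · obtain ⟨ℓ, L, hL, ⟨φ⟩⟩ := hG
    obtain rfl : n = ℓ * (ℓ - 1) / 2 := by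
      rw [← hL.natCard_crossingPoints, ← Nat.card_congr φ.toEquiv, Nat.card_fin]
    beta_reduce
    rw [arrangementPoints_numPseudolines]
    exact hL.exists_drawing φ
  · rintro _ ℓ rfl
    beta_reduce
    rw [arrangementPoints_numPseudolines]
    exact ⟨arrangementPoints_subset ℓ, fun i hi => card_filter_arrangementPoints hi⟩
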